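/- Let $r\ge 2$, $k$ and $n_{\mathrm{cp}}$ be integers with $0\le n_{\mathrm{cp}}<r-1$. On a uniform mesh with cell size $h$ and cell averages $\bar u_j$, let $p_s$ ($s=0,\dots,r-1$) be the polynomial of degree less than $r$ whose averages over the cells of $S_s=\{I_{j+s-r+1},\dots,I_{j+s}\}$ are the given ones, and put $u^s_{j+1/2}=p_s(x_{j+1/2})$, $$\beta_s=\sum_{l=1}^{r-1}\int_{I_j}h^{2l-1}\big(p_s^{(l)}(x)\big)^2\,dx,\qquad d_s=\binom{r-1}{s}\binom{r}{s}\Big/\binom{2r-1}{r}$$ (the ideal weights), and $$\omega_s^{\mathrm{JS}}=\frac{d_s(\epsilon+\beta_s)^{-2}}{\sum_l d_l(\epsilon+\beta_l)^{-2}},\qquad \epsilon>0.$$ For $0<d<1$ let $$g^{\mathrm{PM}}(\omega;d)=c_1(\omega-d)^{k+1}(\omega+c_2)+d,$$ with $c_1=(-1)^k\frac{k+1}{d^{k+1}}$, $c_2=\frac{d}{k+1}$ for $\omega\le d$, and $c_1=-\frac{k+1}{(1-d)^{k+1}}$, $c_2=\frac{d-(k+2)}{k+1}$ for $\omega>d$.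 The $(2r-1)$th-order MOP-WENO-PM$k$ scheme uses the order-preserving mapping $g^{\mathrm{MOP\text{-}PM}}(\omega)=g^{\mathrm{PM}}(\omega;d_{k^*})$, where $k^*$ is the least index minimizing $|\omega-d_i|$, the weights $\omega_s=g^{\mathrm{MOP\text{-}PM}}(\omega_s^{\mathrm{JS}})/\sum_l g^{\mathrm{MOP\text{-}PM}}(\omega_l^{\mathrm{JS}})$, the reconstruction $u^-_{j+1/2}=\sum_s\omega_s u^s_{j+1/2}$ (and $u^+_{j+1/2}$ by mirror symmetry with respect to $x_{j+1/2}$), the flux $\hat f_{j+1/2}=\frac12\big[f(u^-_{j+1/2})+f(u^+_{j+1/2})-\alpha(u^+_{j+1/2}-u^-_{j+1/2})\big]$ with a constant $\alpha$, and the semi-discrete operator $\mathcal L_j=-\frac1h(\hat f_{j+1/2}-\hat f_{j-1/2})$. Let $f:\mathbb R\to\mathbb R$ be twice continuously differentiable, let $u$ be smooth near $x_c$, and let $x_c$ be a critical point of order $n_{\mathrm{cp}}$ of $u$, i.e. $u'(x_c)=\dots=u^{(n_{\mathrm{cp}})}(x_c)=0$ and $u^{(n_{\mathrm{cp}}+1)}(x_c)\ne0$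 (so $n_{\mathrm{cp}}=0$ means $u'(x_c)\neq 0$). Suppose that one of the following holds: (I) $n_{\mathrm{cp}}=0$ and $k\ge1$; (II) $n_{\mathrm{cp}}=1$ and $k\ge1$ (with $k\ge2$ if $r=3$); (III) $n_{\mathrm{cp}}=2$ and $k\ge3$. Then the scheme has the optimal order of accuracy $2r-1$ near $x_c$: there are $C\in\mathbb R$ and $\delta,h_0>0$ such that for all $\epsilon>0$, all $0<h<h_0$ and every cell centre $x_j$ with $|x_j-x_c|<\delta$, the operator applied to the exact cell averages of $u$ satisfies $$\Big|\mathcal L_j+\tfrac1h\big(f(u(x_{j+1/2}))-f(u(x_{j-1/2}))\big)\Big|\le C\,h^{2r-1}.$$ -/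

import Mathlib

open scoped ContDiff

noncomputable section

namespace WENO

/-! Local coordinates: the cell `I_j` has centre `0` and width `1`, so that the cell `I_{j+m}` is
`[m - 1/2, m + 1/2]`, and `a m` is the average over `I_{j+m}`. -/

/-- The `i`-th cell interface (`i = 0, …, r`) of the substencil
`S_s = {I_{j+s-r+1}, …, I_{j+s}}`. -/
def node (r s i : ℕ) : ℝ := (s : ℝ) - r + 1 / 2 + i

/-- The value at the `i`-th interface of the primitive of the cell averages on `S_s`. -/
def primitiveValue (r s : ℕ) (a : ℤ → ℝ) (i : ℕ) : ℝ :=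
  ∑ m ∈ Finset.range i, a ((s : ℤ) - r + 1 + m)

/-- The reconstruction polynomial `p_s` on `S_s`: the polynomial of degree less than `r` whose
averages over the `r` cells of `S_s` are the given ones. It is the derivative of the polynomial
that interpolates the primitive at the `r + 1` interfaces. -/
def substencilPoly (r s : ℕ) (a : ℤ → ℝ) : Polynomial ℝ :=
  Polynomial.derivative
    (Lagrange.interpolate (Finset.range (r + 1)) (node r s) (primitiveValue r s a))

/-- The `r`-th order approximation `u^s_{j+1/2}` of the substencil `S_s`. -/
def substencilValue (r s : ℕ) (a : ℤ → ℝ) : ℝ := (substencilPoly r s a).eval (1 / 2)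

/-- The Jiang–Shu smoothness indicator
`β_s = ∑_{l=1}^{r-1} ∫_{I_j} Δx^{2l-1} (p_s^{(l)})² dx`, in local coordinates. -/
def smoothness (r s : ℕ) (a : ℤ → ℝ) : ℝ :=
  ∑ l ∈ Finset.Icc 1 (r - 1),
    ∫ ξ in (-(1 / 2) : ℝ)..(1 / 2), ((Polynomial.derivative^[l] (substencilPoly r s a)).eval ξ) ^ 2

/-- The ideal weights `d_s` of the `(2r-1)`-th order scheme, those with which the substencil values
combine to the central upstream `(2r-1)`-th order value
(`1/10, 6/10, 3/10` for `r = 3`). -/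
def idealWeight (r s : ℕ) : ℝ :=
  ((r - 1).choose s * r.choose s : ℝ) / ((2 * r - 1).choose r : ℝ)

/-- The unnormalized WENO-JS weights `α_s`. -/
def alphaJS (ε : ℝ) (r s : ℕ) (a : ℤ → ℝ) : ℝ := idealWeight r s / (ε + smoothness r s a) ^ 2

/-- The WENO-JS weights. -/
def weightJS (ε : ℝ) (r s : ℕ) (a : ℤ → ℝ) : ℝ :=
  alphaJS ε r s a / ∑ l ∈ Finset.range r, alphaJS ε r l a

/-- The WENO-PM`k` mapping function `g^{PM}(w; d)` with parameter `d`. -/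
def mapPM (k : ℕ) (d w : ℝ) : ℝ :=
  if w ≤ d then
    (-1) ^ k * ((k + 1) / d ^ (k + 1)) * (w - d) ^ (k + 1) * (w + d / (k + 1)) + d
  else
    -((k + 1) / (1 - d) ^ (k + 1)) * (w - d) ^ (k + 1) * (w + (d - (k + 2)) / (k + 1)) + d

/-- The index `k*`: the least index of an ideal weight that is nearest to `w`. -/
def nearestIndex (r : ℕ) (w : ℝ) : ℕ :=
  sInf {m | m < r ∧ ∀ i < r, |w - idealWeight r m| ≤ |w - idealWeight r i|}

/-- The order-preserving mapping `g^{MOP-PM}`: the mapping function with the parameter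
`d_{k*}` in place of `d_s`. -/
def mapMOPPM (r k : ℕ) (w : ℝ) : ℝ := mapPM k (idealWeight r (nearestIndex r w)) w

/-- The weights `ω_s^{MOP-PM}`. -/
def weightMOPPM (ε : ℝ) (r k s : ℕ) (a : ℤ → ℝ) : ℝ :=
  mapMOPPM r k (weightJS ε r s a) / ∑ l ∈ Finset.range r, mapMOPPM r k (weightJS ε r l a)

/-- The left-biased MOP-WENO-PM`k` reconstruction at `x_{j+1/2}`, from the averages `a m` over
`I_{j+m}`. -/
def reconstruct (ε : ℝ) (r k : ℕ) (a : ℤ → ℝ) : ℝ :=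
  ∑ s ∈ Finset.range r, weightMOPPM ε r k s a * substencilValue r s a

/-- `u^-_{i+1/2}`, where `a m` is the average over `I_m`. -/
def leftValue (ε : ℝ) (r k : ℕ) (a : ℤ → ℝ) (i : ℤ) : ℝ :=
  reconstruct ε r k (fun m => a (i + m))

/-- `u^+_{i+1/2}`, the mirror image of `u^-_{i+1/2}` with respect to `x_{i+1/2}`. -/
def rightValue (ε : ℝ) (r k : ℕ) (a : ℤ → ℝ) (i : ℤ) : ℝ :=
  reconstruct ε r k (fun m => a (i + 1 - m))

/-- The Lax–Friedrichs flux. -/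
def laxFriedrichs (f : ℝ → ℝ) (α a b : ℝ) : ℝ := (f a + f b - α * (b - a)) / 2

/-- The numerical flux at `x_{i+1/2}`. -/
def numericalFlux (f : ℝ → ℝ) (α ε : ℝ) (r k : ℕ) (a : ℤ → ℝ) (i : ℤ) : ℝ :=
  laxFriedrichs f α (leftValue ε r k a i) (rightValue ε r k a i)

/-- The semi-discrete finite volume operator of the MOP-WENO-PM`k` scheme at the cell `I_0`. -/
def spatialOperator (f : ℝ → ℝ) (α ε : ℝ) (r k : ℕ) (h : ℝ) (a : ℤ → ℝ) : ℝ :=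
  -(numericalFlux f α ε r k a 0 - numericalFlux f α ε r k a (-1)) / h

/-- The averages of `u` over the cells `[x + (m - 1/2) h, x + (m + 1/2) h]` of the uniform mesh
with cell size `h` that has `x` as a cell centre. -/
def cellAverage (u : ℝ → ℝ) (x h : ℝ) (m : ℤ) : ℝ :=
  (∫ y in (x + (m - 1 / 2) * h)..(x + (m + 1 / 2) * h), u y) / h

/-- The exact value `-(f(u(x+h/2)) - f(u(x-h/2)))/h` that the finite volume operator approximates,
i.e. the time derivative of the cell average of a solution of `u_t + f(u)_x = 0`. -/
def exactOperator (f u : ℝ → ℝ) (x h : ℝ) : ℝ :=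
  -(f (u (x + h / 2)) - f (u (x - h / 2))) / h

/-- `xc` is a critical point of order `n` of `u`; `n = 0` means `u' ≠ 0`. -/
def HasCriticalOrder (u : ℝ → ℝ) (xc : ℝ) (n : ℕ) : Prop :=
  (∀ l, 1 ≤ l → l ≤ n → iteratedDeriv l u xc = 0) ∧ iteratedDeriv (n + 1) u xc ≠ 0

/-- The `(2r-1)`-th order MOP-WENO-PM`k` scheme has the optimal order of accuracy `2r-1` near
`xc`: the truncation error of the semi-discrete scheme is `O(h^{2r-1})`, uniformly in the
position `x` of the cell near `xc` and in the regularization parameter `ε > 0`. -/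
def AchievesOptimalOrder (r k : ℕ) (f : ℝ → ℝ) (α : ℝ) (u : ℝ → ℝ) (xc : ℝ) : Prop :=
  ∃ C δ h₀ : ℝ, 0 < δ ∧ 0 < h₀ ∧
    ∀ ε : ℝ, 0 < ε → ∀ h : ℝ, 0 < h → h < h₀ → ∀ x : ℝ, |x - xc| < δ →
      |spatialOperator f α ε r k h (cellAverage u x h) - exactOperator f u x h|
        ≤ C * h ^ (2 * r - 1)

end WENO

end

noncomputable section

namespace WENO

section Reconstruction

open Polynomial Finset

/-! The nonlinear scheme is a perturbation of size `h ^ (2 * r)` of the linear scheme with the ideal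
weights, and the linear scheme has a truncation error with a smooth leading term.

Near `xc` the derivative of order `n + 1`, with `n = ncp`, stays away from zero. Hence every `β_s`
is at least a constant times `h ^ (2 * (n + 1))`, while the `p_s` differ from each other by `O(h ^
r)` only. The `β_s` therefore agree up to a relative error `O(h ^ (r - 1 - n))`, and so do the
Jiang–Shu weights with the ideal ones; adding `ε > 0` only helps (`exists_abs_weightJS_sub_le`). For
small `h` the nearest ideal weight is the right one, and the mapping is flat there to order `k`, so
the mapped weights are off by `O(h ^ ((r - 1 - n) * (k + 1)))`. If `r ≤ (r - 1 - n) * (k + 1)`, this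
is `O(h ^ r)`. Weights summing to one see only the deviations of the substencil values from a common
value, again `O(h ^ r)`, so the two reconstructions differ by `O(h ^ (2 * r))`
(`exists_abs_reconstruct_sub_le`).

The ideal weights are exact to degree `2 * r - 2`, so the linear error is a constant times `u^(2r-1)
* h ^ (2 * r - 1)` plus `O(h ^ (2 * r))`. Errors at neighbouring interfaces thus differ by `O(h ^ (2
* r))` (`DerivBound.exists_abs_reconstructError_le`). The flux keeps this cancellation because `f`
is `C²`, and dividing by `h` leaves `O(h ^ (2 * r - 1))`. The three cases of the theorem are
instances of the exponent inequality. -/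

/-! ### Exactness of the ideal weights on polynomials -/

theorem sum_alternating_choose_mul_shift (n : ℕ) (F : ℝ → ℝ) (y : ℝ) :
    ∑ i ∈ range (n + 1), (-1) ^ i * (n.choose i : ℝ) * F (y + i)
      = (-1) ^ n * (fwdDiff (1 : ℝ))^[n] F y := by
  rw [fwdDiff_iter_eq_sum_shift, Finset.mul_sum]
  refine Finset.sum_congr rfl fun i hi => ?_
  have hi' : i ≤ n := by simpa [Nat.lt_succ_iff] using hi
  obtain ⟨j, rfl⟩ := Nat.exists_eq_add_of_le hi'
  simp only [Nat.add_sub_cancel_left, nsmul_eq_mul, mul_one, zsmul_eq_mul]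
  push_cast
  have h1 : ((-1 : ℝ) ^ j) * (-1) ^ j = 1 := by rw [← mul_pow]; simp
  rw [pow_add]
  linear_combination (-(-1 : ℝ) ^ i * ((i + j).choose i : ℝ) * F (y + i)) * h1

theorem eval_divX_sub_C (Q : ℝ[X]) (c x : ℝ) :
    Q.eval x - Q.eval c = (x - c) * (Q /ₘ (X - C c)).eval x := by
  have h := congrArg (Polynomial.eval x) (X_sub_C_mul_divByMonic_eq_sub_modByMonic Q c)
  simpa [modByMonic_X_sub_C_eq_C_eval] using h.symm

theorem eval_derivative_eq_eval_divX_sub_C (Q : ℝ[X]) (c : ℝ) :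
    (derivative Q).eval c = (Q /ₘ (X - C c)).eval c := by
  have h := X_sub_C_mul_divByMonic_eq_sub_modByMonic Q c
  rw [modByMonic_X_sub_C_eq_C_eval] at h
  have h2 := congrArg (fun p => (derivative p).eval c) h
  simpa using h2.symm

theorem natDegree_divX_sub_C_lt {Q : ℝ[X]} {n : ℕ} (c : ℝ) (hQ : Q.natDegree ≤ n) (hn : 0 < n) :
    (Q /ₘ (X - C c)).natDegree < n := by
  rw [natDegree_divByMonic Q (monic_X_sub_C c), natDegree_X_sub_C]
  omega

theorem node_injective (r s : ℕ) : Function.Injective (node r s) := by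
  intro i j h
  simpa [node] using h

theorem node_sub {r s : ℕ} (hs : s < r) : node r s (r - s) = 1 / 2 := by
  unfold node
  rw [Nat.cast_sub hs.le]
  ring

/-- The difference quotients of `P` and `Q` based at `1 / 2` agree at every node except `1 / 2`
itself, where they equal the derivatives. The `r`-th difference of the quotient of `P` vanishes by
degree, so that of `Q` reduces to the single term `i = r - s`. -/
theorem choose_mul_derivative_sub {r s : ℕ} (hs : s < r) {P Q : ℝ[X]} (hP : P.natDegree ≤ r)
    (hPQ : ∀ i ≤ r, P.eval (node r s i) = Q.eval (node r s i)) :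
    (r.choose s : ℝ) * ((derivative Q).eval (1 / 2) - (derivative P).eval (1 / 2))
      = (-1) ^ s * (fwdDiff (1 : ℝ))^[r] (Q /ₘ (X - C (1 / 2))).eval ((-r + 1 / 2 : ℝ) + s) := by
  rw [eval_derivative_eq_eval_divX_sub_C, eval_derivative_eq_eval_divX_sub_C]
  set gQ := Q /ₘ (X - C (1 / 2)) with hgQ
  set gP := P /ₘ (X - C (1 / 2)) with hgP
  have hc : P.eval (1 / 2) = Q.eval (1 / 2) := by
    rw [← node_sub hs]; exact hPQ _ (Nat.sub_le _ _)
  have hne : ∀ i ≤ r, i ≠ r - s → gP.eval (node r s i) = gQ.eval (node r s i) := by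
    intro i hi his
    have h1 := eval_divX_sub_C P (1 / 2) (node r s i)
    have h2 := eval_divX_sub_C Q (1 / 2) (node r s i)
    rw [hPQ i hi, hc, h2] at h1
    have h3 : node r s i - 1 / 2 ≠ 0 := by
      rw [sub_ne_zero, ← node_sub hs]
      exact fun h => his (node_injective r s h)
    exact (mul_left_cancel₀ h3 h1).symm
  have hnode : ∀ i : ℕ, node r s i = ((-r + 1 / 2 : ℝ) + s) + i := by
    intro i; unfold node; ring
  have hsumP := sum_alternating_choose_mul_shift r gP.eval ((-r + 1 / 2 : ℝ) + s)
  have hsumQ := sum_alternating_choose_mul_shift r gQ.eval ((-r + 1 / 2 : ℝ) + s)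
  rw [Polynomial.fwdDiff_iter_eq_zero_of_degree_lt
    (natDegree_divX_sub_C_lt (1 / 2) hP (by omega) : gP.natDegree < r)] at hsumP
  have hdiff : ∑ i ∈ range (r + 1), ((-1) ^ i * (r.choose i : ℝ) * gQ.eval (node r s i)
      - (-1) ^ i * (r.choose i : ℝ) * gP.eval (node r s i))
      = (-1) ^ (r - s) * (r.choose (r - s) : ℝ) * gQ.eval (node r s (r - s))
      - (-1) ^ (r - s) * (r.choose (r - s) : ℝ) * gP.eval (node r s (r - s)) := by
    refine Finset.sum_eq_single_of_mem (r - s) (by simp) fun i hi his => ?_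
    rw [hne i (by simpa [Nat.lt_succ_iff] using hi) his, sub_self]
  rw [Finset.sum_sub_distrib] at hdiff
  simp only [hnode] at hdiff
  rw [hsumP, hsumQ, ← hnode, node_sub hs, Nat.choose_symm hs.le] at hdiff
  have h1 : ((-1 : ℝ) ^ (r - s)) * (-1) ^ (r - s) = 1 := by rw [← mul_pow]; simp
  have h2 : ((-1 : ℝ) ^ (r - s)) * (-1) ^ r = (-1) ^ s := by
    rw [← pow_add, show r - s + r = s + 2 * (r - s) by omega, pow_add, pow_mul]; simp
  simp only [Pi.zero_apply, mul_zero, sub_zero] at hdiff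
  rw [← h2]
  linear_combination (-(-1 : ℝ) ^ (r - s)) * hdiff
    - (r.choose s : ℝ) * (gQ.eval (1 / 2) - gP.eval (1 / 2)) * h1

/-- Each substencil error is an `r`-th difference based at a point that moves by one with `s`.
Weighting by `(r - 1).choose s` takes a further `(r - 1)`-th difference, and a difference of order
`2 * r - 1` kills the quotient of `Q`. This is where the ideal weights come from. -/
theorem sum_choose_mul_derivative_sub {r : ℕ} (hr : 0 < r) {Q : ℝ[X]}
    (hQ : Q.natDegree ≤ 2 * r - 1) {P : ℕ → ℝ[X]} (hP : ∀ s < r, (P s).natDegree ≤ r)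
    (hPQ : ∀ s < r, ∀ i ≤ r, (P s).eval (node r s i) = Q.eval (node r s i)) :
    ∑ s ∈ range r, ((r - 1).choose s : ℝ) * ((r.choose s : ℝ) *
      ((derivative Q).eval (1 / 2) - (derivative (P s)).eval (1 / 2))) = 0 := by
  have h1 : ∀ s ∈ range r, ((r - 1).choose s : ℝ) * ((r.choose s : ℝ) *
      ((derivative Q).eval (1 / 2) - (derivative (P s)).eval (1 / 2)))
      = (-1) ^ s * ((r - 1).choose s : ℝ) *
        (fwdDiff (1 : ℝ))^[r] (Q /ₘ (X - C (1 / 2))).eval ((-r + 1 / 2 : ℝ) + s) := by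
    intro s hs
    have hs' := Finset.mem_range.1 hs
    rw [choose_mul_derivative_sub hs' (hP s hs') (hPQ s hs')]
    ring
  rw [Finset.sum_congr rfl h1]
  have h2 := sum_alternating_choose_mul_shift (r - 1)
    ((fwdDiff (1 : ℝ))^[r] (Q /ₘ (X - C (1 / 2))).eval) (-r + 1 / 2)
  rw [show r - 1 + 1 = r by omega, ← Function.iterate_add_apply,
    show r - 1 + r = 2 * r - 1 by omega, Polynomial.fwdDiff_iter_eq_zero_of_degree_lt
      (natDegree_divX_sub_C_lt (1 / 2) hQ (by omega))] at h2
  simpa using h2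

theorem sum_choose_mul_choose {r : ℕ} (hr : 0 < r) :
    ∑ s ∈ range r, ((r - 1).choose s * r.choose s : ℝ) = ((2 * r - 1).choose r : ℝ) := by
  have h := Nat.add_choose_eq r (r - 1) (r - 1)
  rw [Finset.Nat.sum_antidiagonal_eq_sum_range_succ_mk] at h
  rw [show (2 * r - 1).choose r = (r + (r - 1)).choose (r - 1) by
    rw [show 2 * r - 1 = r + (r - 1) by omega]; exact Nat.choose_symm_add, h]
  push_cast
  rw [Nat.succ_eq_add_one, Nat.sub_add_cancel (by omega : 1 ≤ r)]
  refine Finset.sum_congr rfl fun s hs => ?_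
  rw [Nat.choose_symm (by have := Finset.mem_range.1 hs; omega)]
  ring

theorem choose_two_mul_sub_one_pos {r : ℕ} (hr : 0 < r) : (0 : ℝ) < ((2 * r - 1).choose r : ℝ) := by
  exact_mod_cast Nat.choose_pos (by omega)

theorem sum_idealWeight {r : ℕ} (hr : 0 < r) : ∑ s ∈ range r, idealWeight r s = 1 := by
  unfold idealWeight
  rw [← Finset.sum_div, sum_choose_mul_choose hr, div_self (choose_two_mul_sub_one_pos hr).ne']

/-- The cell averages of the derivative of a polynomial. -/
def polyAverage (Q : ℝ[X]) (m : ℤ) : ℝ := Q.eval (m + 1 / 2 : ℝ) - Q.eval (m - 1 / 2 : ℝ)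

theorem primitiveValue_polyAverage (r s : ℕ) (Q : ℝ[X]) (i : ℕ) :
    primitiveValue r s (polyAverage Q) i = Q.eval (node r s i) - Q.eval (node r s 0) := by
  unfold primitiveValue
  rw [← Finset.sum_range_sub (fun i => Q.eval (node r s i))]
  refine Finset.sum_congr rfl fun m _ => ?_
  unfold polyAverage node
  push_cast
  congr 2 <;> ring

theorem natDegree_interpolate_node_le (r s : ℕ) (v : ℕ → ℝ) :
    (Lagrange.interpolate (range (r + 1)) (node r s) v).natDegree ≤ r := by
  refine natDegree_le_of_degree_le ?_
  simpa using Lagrange.degree_interpolate_le (s := range (r + 1)) v (node_injective r s).injOn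

theorem substencilPoly_polyAverage {r : ℕ} (s : ℕ) {Q : ℝ[X]} (hQ : Q.natDegree ≤ r) :
    substencilPoly r s (polyAverage Q) = derivative Q := by
  have h := Lagrange.eq_interpolate_of_eval_eq (s := range (r + 1)) (v := node r s)
    (primitiveValue r s (polyAverage Q)) (f := Q - C (Q.eval (node r s 0)))
    (node_injective r s).injOn ?_ ?_
  · unfold substencilPoly
    rw [← h]
    simp
  · rw [Finset.card_range]
    refine lt_of_le_of_lt degree_le_natDegree ?_
    rw [natDegree_sub_C]
    exact_mod_cast Nat.lt_succ_of_le hQ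
  · intro i _
    rw [primitiveValue_polyAverage]
    simp

/-- The linear combination of the substencil values with the ideal weights. -/
def idealReconstruct (r : ℕ) (a : ℤ → ℝ) : ℝ :=
  ∑ s ∈ range r, idealWeight r s * substencilValue r s a

theorem idealReconstruct_polyAverage {r : ℕ} (hr : 0 < r) {Q : ℝ[X]}
    (hQ : Q.natDegree ≤ 2 * r - 1) :
    idealReconstruct r (polyAverage Q) = (derivative Q).eval (1 / 2) := by
  -- The interpolated primitive vanishes at the first node; adding the constant `Q.eval (node r s
  -- 0)` makes it interpolate `Q` without changing its derivative.
  have h := sum_choose_mul_derivative_sub hr hQ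
    (P := fun s => Lagrange.interpolate (range (r + 1)) (node r s)
      (primitiveValue r s (polyAverage Q)) + C (Q.eval (node r s 0)))
    (fun s _ => by rw [natDegree_add_C]; exact natDegree_interpolate_node_le _ _ _)
    (fun s _ i hi => by
      rw [eval_add, Lagrange.eval_interpolate_at_node _ (node_injective r s).injOn
        (by simp; omega), primitiveValue_polyAverage]
      simp)
  have hpos := choose_two_mul_sub_one_pos hr
  have h' : ∑ s ∈ range r, (idealWeight r s * (derivative Q).eval (1 / 2)
      - idealWeight r s * substencilValue r s (polyAverage Q)) = 0 := by
    have h3 := congrArg (fun t => ((2 * r - 1).choose r : ℝ)⁻¹ * t) h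
    simp only [mul_zero, Finset.mul_sum] at h3
    rw [← h3]
    refine Finset.sum_congr rfl fun s _ => ?_
    unfold substencilValue substencilPoly idealWeight
    rw [derivative_add, derivative_C, add_zero]
    field_simp
  rw [Finset.sum_sub_distrib, ← Finset.sum_mul, sum_idealWeight hr, one_mul] at h'
  unfold idealReconstruct
  linarith

/-! ### Uniform bounds for the substencil polynomials -/

theorem exists_uniform_of_forall_lt {p : ℕ → ℝ → Prop} (n : ℕ)
    (hmono : ∀ i K K', K ≤ K' → p i K → p i K') (h : ∀ i < n, ∃ K, p i K) :
    ∃ K, ∀ i < n, p i K := by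
  induction n with
  | zero => exact ⟨0, by simp⟩
  | succ n ih =>
    obtain ⟨K, hK⟩ := ih fun i hi => h i (by omega)
    obtain ⟨K', hK'⟩ := h n (by omega)
    refine ⟨max K K', fun i hi => ?_⟩
    rcases Nat.lt_succ_iff_lt_or_eq.1 hi with h1 | rfl
    · exact hmono i _ _ (le_max_left _ _) (hK i h1)
    · exact hmono i _ _ (le_max_right _ _) hK'

theorem primitiveValue_sub (r s : ℕ) (a b : ℤ → ℝ) :
    primitiveValue r s (a - b) = primitiveValue r s a - primitiveValue r s b := by
  ext i
  simp [primitiveValue, Finset.sum_sub_distrib]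

theorem substencilPoly_sub (r s : ℕ) (a b : ℤ → ℝ) :
    substencilPoly r s (a - b) = substencilPoly r s a - substencilPoly r s b := by
  unfold substencilPoly
  rw [primitiveValue_sub, map_sub, derivative_sub]

theorem abs_primitiveValue_le {r s i : ℕ} (hs : s < r) (hi : i ≤ r) {a : ℤ → ℝ} {η : ℝ}
    (ha : ∀ m : ℤ, |m| ≤ r → |a m| ≤ η) : |primitiveValue r s a i| ≤ r * η := by
  have hη : 0 ≤ η := (abs_nonneg _).trans (ha 0 (by simp))
  unfold primitiveValue
  calc _ ≤ ∑ m ∈ range i, |a ((s : ℤ) - r + 1 + m)| := Finset.abs_sum_le_sum_abs _ _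
    _ ≤ ∑ m ∈ range i, η := by
        refine Finset.sum_le_sum fun m hm => ha _ ?_
        have := Finset.mem_range.1 hm
        rw [abs_le]
        constructor <;> omega
    _ = i * η := by simp
    _ ≤ r * η := by gcongr

theorem exists_abs_eval_le (p : ℝ[X]) : ∃ K, ∀ ξ ∈ Set.Icc (-(1 / 2) : ℝ) (1 / 2), |p.eval ξ| ≤ K := by
  obtain ⟨K, hK⟩ := isCompact_Icc.exists_bound_of_continuousOn
    (p.continuous.continuousOn (s := Set.Icc (-(1 / 2) : ℝ) (1 / 2)))
  exact ⟨K, hK⟩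

theorem exists_substencilPoly_bound_aux {r s : ℕ} (hs : s < r) (l : ℕ) :
    ∃ K, ∀ (a : ℤ → ℝ) (η : ℝ), (∀ m : ℤ, |m| ≤ r → |a m| ≤ η) →
      ∀ ξ ∈ Set.Icc (-(1 / 2) : ℝ) (1 / 2),
        |(derivative^[l] (substencilPoly r s a)).eval ξ| ≤ K * η := by
  choose K hK using fun i => exists_abs_eval_le
    (derivative^[l + 1] (Lagrange.basis (range (r + 1)) (node r s) i))
  -- `K i` bounds the Lagrange basis polynomials, differentiated once more because `p_s` is itself a
  -- derivative; the factor `r` bounds the primitive, a sum of at most `r` averages.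
  refine ⟨∑ i ∈ range (r + 1), r * K i, fun a η ha ξ hξ => ?_⟩
  have h0 : (derivative^[l] (substencilPoly r s a)).eval ξ
      = ∑ i ∈ range (r + 1), primitiveValue r s a i *
        (derivative^[l + 1] (Lagrange.basis (range (r + 1)) (node r s) i)).eval ξ := by
    unfold substencilPoly
    rw [← Function.iterate_succ_apply, Lagrange.interpolate_apply, iterate_derivative_sum,
      eval_finsetSum]
    refine Finset.sum_congr rfl fun i _ => ?_
    rw [iterate_derivative_C_mul, eval_mul, eval_C]
  rw [h0, Finset.sum_mul]
  refine (Finset.abs_sum_le_sum_abs _ _).trans (Finset.sum_le_sum fun i hi => ?_)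
  have hi' : i ≤ r := Nat.lt_succ_iff.1 (Finset.mem_range.1 hi)
  have h1 := abs_primitiveValue_le hs hi' ha
  rw [abs_mul, mul_right_comm]
  exact mul_le_mul h1 (hK i ξ hξ) (abs_nonneg _) ((abs_nonneg _).trans h1)

theorem exists_substencilPoly_bound (r : ℕ) :
    ∃ K, 0 ≤ K ∧ ∀ s < r, ∀ l < r, ∀ (a : ℤ → ℝ) (η : ℝ), (∀ m : ℤ, |m| ≤ r → |a m| ≤ η) →
      ∀ ξ ∈ Set.Icc (-(1 / 2) : ℝ) (1 / 2),
        |(derivative^[l] (substencilPoly r s a)).eval ξ| ≤ K * η := by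
  have hmono : ∀ s l : ℕ, ∀ K K' : ℝ, K ≤ K' → (∀ (a : ℤ → ℝ) (η : ℝ),
      (∀ m : ℤ, |m| ≤ r → |a m| ≤ η) → ∀ ξ ∈ Set.Icc (-(1 / 2) : ℝ) (1 / 2),
        |(derivative^[l] (substencilPoly r s a)).eval ξ| ≤ K * η) → (∀ (a : ℤ → ℝ) (η : ℝ),
      (∀ m : ℤ, |m| ≤ r → |a m| ≤ η) → ∀ ξ ∈ Set.Icc (-(1 / 2) : ℝ) (1 / 2),
        |(derivative^[l] (substencilPoly r s a)).eval ξ| ≤ K' * η) := by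
    intro s l K K' hKK' h a η ha ξ hξ
    have hη : 0 ≤ η := (abs_nonneg _).trans (ha 0 (by simp))
    exact (h a η ha ξ hξ).trans (mul_le_mul_of_nonneg_right hKK' hη)
  obtain ⟨K, hK⟩ := exists_uniform_of_forall_lt r
    (fun s K K' h h' l hl => hmono s l K K' h (h' l hl)) fun s hs =>
      exists_uniform_of_forall_lt r (hmono s) fun l _ => exists_substencilPoly_bound_aux hs l
  exact ⟨max K 0, le_max_right _ _, fun s hs l hl =>
    hmono s l _ _ (le_max_left _ _) (hK s hs l hl)⟩

/-! ### Comparison of smoothness indicators -/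

theorem intervalIntegrable_eval_sq (p : ℝ[X]) (a b : ℝ) :
    IntervalIntegrable (fun ξ => p.eval ξ ^ 2) MeasureTheory.volume a b :=
  (p.continuous.pow 2).intervalIntegrable a b

theorem smoothness_nonneg (r s : ℕ) (a : ℤ → ℝ) : 0 ≤ smoothness r s a :=
  Finset.sum_nonneg fun _ _ =>
    intervalIntegral.integral_nonneg (by norm_num) fun _ _ => sq_nonneg _

theorem sq_le_smoothness {r l : ℕ} (hl : 1 ≤ l) (hlr : l < r) (s : ℕ) (a : ℤ → ℝ) {c : ℝ}
    (hc : 0 ≤ c) (h : ∀ ξ ∈ Set.Icc (-(1 / 2) : ℝ) (1 / 2),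
      c ≤ |(derivative^[l] (substencilPoly r s a)).eval ξ|) : c ^ 2 ≤ smoothness r s a := by
  have h1 : c ^ 2 ≤ ∫ ξ in (-(1 / 2) : ℝ)..(1 / 2),
      ((derivative^[l] (substencilPoly r s a)).eval ξ) ^ 2 := by
    have h2 : c ^ 2 = ∫ _ξ in (-(1 / 2) : ℝ)..(1 / 2), c ^ 2 := by
      rw [intervalIntegral.integral_const]; norm_num
    rw [h2]
    refine intervalIntegral.integral_mono_on (by norm_num) (by simp)
      (intervalIntegrable_eval_sq _ _ _) fun ξ hξ => ?_
    rw [← sq_abs (eval _ _)]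
    exact pow_le_pow_left₀ hc (h ξ hξ) 2
  refine h1.trans ?_
  unfold smoothness
  exact Finset.single_le_sum (f := fun l => ∫ ξ in (-(1 / 2) : ℝ)..(1 / 2),
      ((derivative^[l] (substencilPoly r s a)).eval ξ) ^ 2)
    (fun _ _ => intervalIntegral.integral_nonneg (by norm_num) fun _ _ => sq_nonneg _)
    (Finset.mem_Icc.2 ⟨hl, by omega⟩)

/-- Weighted AM-GM, `2 * |y| ≤ y ^ 2 / μ + μ`, removes the linear term in `|y|`, so that the bound
integrates to a multiple of an indicator plus a constant. -/
theorem abs_sq_sub_sq_le {x y δ μ : ℝ} (hμ : 0 < μ) (hδμ : δ ≤ μ) (h : |x - y| ≤ δ) :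
    |x ^ 2 - y ^ 2| ≤ δ / μ * y ^ 2 + 2 * δ * μ := by
  have hδ : 0 ≤ δ := (abs_nonneg _).trans h
  have h1 : |x ^ 2 - y ^ 2| ≤ δ * (2 * |y| + δ) := by
    rw [show x ^ 2 - y ^ 2 = (x - y) * (2 * y + (x - y)) by ring, abs_mul]
    refine mul_le_mul h ((abs_add_le _ _).trans ?_) (abs_nonneg _) hδ
    rw [abs_mul, abs_two]
    linarith
  have h2 : 2 * |y| ≤ y ^ 2 / μ + μ := by
    rw [div_add' _ _ _ hμ.ne', le_div_iff₀ hμ, ← sq_abs y]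
    nlinarith [sq_nonneg (|y| - μ)]
  calc _ ≤ δ * (2 * |y| + δ) := h1
    _ ≤ δ * (y ^ 2 / μ + μ + μ) := by gcongr
    _ = _ := by ring

/-- The constant term `2 * δ * μ` is `δ / μ` times `2 * μ ^ 2`, and the lower bound on the indicator
absorbs it; the estimate becomes relative, of size `δ / μ`. -/
theorem abs_smoothness_sub_le {r s t : ℕ} {a : ℤ → ℝ} {δ μ c : ℝ} (hμ : 0 < μ) (hδμ : δ ≤ μ)
    (hδ : 0 ≤ δ) (hc : 0 < c) (h : ∀ l < r, ∀ ξ ∈ Set.Icc (-(1 / 2) : ℝ) (1 / 2),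
      |(derivative^[l] (substencilPoly r s a)).eval ξ
        - (derivative^[l] (substencilPoly r t a)).eval ξ| ≤ δ)
    (hβ : c * μ ^ 2 ≤ smoothness r t a) :
    |smoothness r s a - smoothness r t a| ≤ (1 + 2 * r / c) * (δ / μ) * smoothness r t a := by
  have h1 : |smoothness r s a - smoothness r t a|
      ≤ ∑ l ∈ Finset.Icc 1 (r - 1), (δ / μ * (∫ ξ in (-(1 / 2) : ℝ)..(1 / 2),
        ((derivative^[l] (substencilPoly r t a)).eval ξ) ^ 2) + 2 * δ * μ) := by
    unfold smoothness
    rw [← Finset.sum_sub_distrib]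
    refine (Finset.abs_sum_le_sum_abs _ _).trans (Finset.sum_le_sum fun l hl => ?_)
    have hl' : l < r := by have := Finset.mem_Icc.1 hl; omega
    set f := derivative^[l] (substencilPoly r s a)
    set g := derivative^[l] (substencilPoly r t a)
    rw [← intervalIntegral.integral_sub (intervalIntegrable_eval_sq _ _ _)
      (intervalIntegrable_eval_sq _ _ _)]
    have h3 : δ / μ * (∫ ξ in (-(1 / 2) : ℝ)..(1 / 2), (g.eval ξ) ^ 2) + 2 * δ * μ
        = ∫ ξ in (-(1 / 2) : ℝ)..(1 / 2), (δ / μ * (g.eval ξ) ^ 2 + 2 * δ * μ) := by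
      rw [intervalIntegral.integral_add ((intervalIntegrable_eval_sq _ _ _).const_mul _) (by simp),
        intervalIntegral.integral_const_mul, intervalIntegral.integral_const]
      norm_num
    rw [h3]
    refine (intervalIntegral.abs_integral_le_integral_abs (by norm_num)).trans ?_
    refine intervalIntegral.integral_mono_on (by norm_num)
      (((f.continuous.pow 2).sub (g.continuous.pow 2)).abs.intervalIntegrable _ _)
      (((continuous_const.mul (g.continuous.pow 2)).add continuous_const).intervalIntegrable _ _)
      fun ξ hξ => abs_sq_sub_sq_le hμ hδμ (h l hl' ξ hξ)
  refine h1.trans ?_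
  rw [Finset.sum_add_distrib, ← Finset.mul_sum, Finset.sum_const, Nat.card_Icc, nsmul_eq_mul]
  change δ / μ * smoothness r t a + _ ≤ _
  have h4 : ((r - 1 + 1 - 1 : ℕ) : ℝ) * (2 * δ * μ) ≤ 2 * r / c * (δ / μ) * smoothness r t a := by
    calc _ ≤ (r : ℝ) * (2 * δ * μ) := by
          gcongr
          omega
      _ = 2 * r / c * (δ / μ) * (c * μ ^ 2) := by field_simp
      _ ≤ _ := by gcongr
  linarith

/-! ### Jiang–Shu weights -/

theorem idealWeight_nonneg (r s : ℕ) : 0 ≤ idealWeight r s := by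
  unfold idealWeight; positivity

theorem idealWeight_le_one {r s : ℕ} (hs : s < r) : idealWeight r s ≤ 1 := by
  rw [← sum_idealWeight (r := r) (by omega)]
  exact Finset.single_le_sum (fun l _ => idealWeight_nonneg r l) (Finset.mem_range.2 hs)

/-- A relative bound on the indicators survives adding `ε` to both, which makes the result uniform
in `ε`. The weight is `d_s / D`, with `D` the ideal average of the squared ratios; each square is
within `3 * θ` of `1`, and `D ≥ 1 / 2` doubles the constant to `6`. -/
theorem abs_weightJS_sub_le {r : ℕ} {a : ℤ → ℝ} {θ ε : ℝ} (hθ0 : 0 ≤ θ) (hθ : θ ≤ 1 / 6) (hε : 0 < ε)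
    (h : ∀ s < r, ∀ t < r, |smoothness r s a - smoothness r t a| ≤ θ * smoothness r t a)
    {s : ℕ} (hs : s < r) : |weightJS ε r s a - idealWeight r s| ≤ 6 * θ := by
  have hpos : ∀ l, 0 < ε + smoothness r l a := fun l =>
    add_pos_of_pos_of_nonneg hε (smoothness_nonneg r l a)
  set ρ : ℕ → ℝ := fun l => ((ε + smoothness r s a) / (ε + smoothness r l a)) ^ 2 with hρ
  have hρ1 : ∀ l < r, |ρ l - 1| ≤ 3 * θ := by
    intro l hl
    have hb := h s hs l hl
    set q := (ε + smoothness r s a) / (ε + smoothness r l a) with hq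
    have hq1 : |q - 1| ≤ θ := by
      rw [hq, div_sub_one (hpos l).ne', abs_div, abs_of_pos (hpos l), div_le_iff₀ (hpos l)]
      rw [show ε + smoothness r s a - (ε + smoothness r l a)
        = smoothness r s a - smoothness r l a by ring]
      nlinarith
    change |q ^ 2 - 1| ≤ _
    obtain ⟨h1, h2⟩ := abs_le.1 hq1
    rw [abs_le]
    constructor <;> nlinarith
  set D := ∑ l ∈ range r, idealWeight r l * ρ l with hD
  have hD1 : |D - 1| ≤ 3 * θ := by
    rw [hD, ← sum_idealWeight (r := r) (by omega), ← Finset.sum_sub_distrib]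
    refine (Finset.abs_sum_le_sum_abs _ _).trans ?_
    calc _ ≤ ∑ l ∈ range r, idealWeight r l * (3 * θ) := by
          refine Finset.sum_le_sum fun l hl => ?_
          rw [show idealWeight r l * ρ l - idealWeight r l = idealWeight r l * (ρ l - 1) by ring,
            abs_mul, abs_of_nonneg (idealWeight_nonneg r l)]
          exact mul_le_mul_of_nonneg_left (hρ1 l (Finset.mem_range.1 hl)) (idealWeight_nonneg r l)
      _ = 3 * θ := by rw [← Finset.sum_mul, sum_idealWeight (by omega), one_mul]
  have hDpos : 1 / 2 ≤ D := by
    have := (abs_le.1 hD1).1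
    linarith
  have hw : weightJS ε r s a = idealWeight r s / D := by
    have h1 : ∑ l ∈ range r, alphaJS ε r l a = D / (ε + smoothness r s a) ^ 2 := by
      rw [hD, Finset.sum_div]
      refine Finset.sum_congr rfl fun l _ => ?_
      have := (hpos l).ne'
      have := (hpos s).ne'
      simp only [hρ, alphaJS]
      field_simp
    have := (hpos s).ne'
    unfold weightJS
    rw [h1, alphaJS]
    field_simp
  rw [hw, div_sub' (by linarith), abs_div, abs_of_pos (show 0 < D by linarith),
    div_le_iff₀ (by linarith), show idealWeight r s - D * idealWeight r s
      = idealWeight r s * -(D - 1) by ring, abs_mul, abs_neg,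
    abs_of_nonneg (idealWeight_nonneg r s)]
  calc _ ≤ 1 * (3 * θ) := mul_le_mul (idealWeight_le_one hs) hD1 (abs_nonneg _) zero_le_one
    _ = 6 * θ * (1 / 2) := by ring
    _ ≤ 6 * θ * D := by gcongr

/-! ### The order-preserving mapping -/

/-- The conclusion concerns values rather than indices: the mapping depends on `k*` only through its
ideal weight, so the weights need not be pairwise distinct. -/
theorem exists_idealWeight_gap (r : ℕ) :
    ∃ γ, 0 < γ ∧ ∀ s < r, ∀ t < r, |idealWeight r s - idealWeight r t| < γ →
      idealWeight r s = idealWeight r t := by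
  have h : ∀ n : ℕ, ∀ v : ℕ → ℝ, ∃ K : ℝ, ∀ s < n, v s ≠ 0 → |v s|⁻¹ ≤ K := fun n v =>
    exists_uniform_of_forall_lt n (p := fun s K => v s ≠ 0 → |v s|⁻¹ ≤ K)
      (fun _ _ _ h h' hv => (h' hv).trans h) fun s _ => ⟨|v s|⁻¹, fun _ => le_rfl⟩
  obtain ⟨K, hK⟩ := exists_uniform_of_forall_lt r
    (p := fun s K => ∀ t < r, idealWeight r s - idealWeight r t ≠ 0 →
      |idealWeight r s - idealWeight r t|⁻¹ ≤ K)
    (fun _ _ _ h h' t ht hv => (h' t ht hv).trans h)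
    fun s _ => h r fun t => idealWeight r s - idealWeight r t
  refine ⟨(max K 1)⁻¹, by positivity, fun s hs t ht hst => ?_⟩
  by_contra hne
  have h1 := hK s hs t ht (sub_ne_zero.2 hne)
  have h2 : 0 < |idealWeight r s - idealWeight r t| := abs_pos.2 (sub_ne_zero.2 hne)
  have h3 := (lt_inv_comm₀ h2 (by positivity)).1 hst
  exact absurd (h1.trans (le_max_left K 1)) (not_le.2 h3)

theorem nearestIndex_spec {r : ℕ} (hr : 0 < r) (w : ℝ) :
    nearestIndex r w < r ∧
      ∀ i < r, |w - idealWeight r (nearestIndex r w)| ≤ |w - idealWeight r i| := by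
  refine Nat.sInf_mem (s := {m | m < r ∧ ∀ i < r, |w - idealWeight r m| ≤ |w - idealWeight r i|}) ?_
  obtain ⟨m, hm, hmin⟩ := Finset.exists_min_image (range r) (fun i => |w - idealWeight r i|)
    ⟨0, Finset.mem_range.2 hr⟩
  exact ⟨m, Finset.mem_range.1 hm, fun i hi => hmin i (Finset.mem_range.2 hi)⟩

theorem exists_abs_mapPM_sub_le (k : ℕ) (d : ℝ) :
    ∃ K, ∀ w, |w - d| ≤ 1 → |mapPM k d w - d| ≤ K * |w - d| ^ (k + 1) := by
  have key : ∀ c b w : ℝ, |w - d| ≤ 1 →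
      |c * (w - d) ^ (k + 1) * (w + b) + d - d| ≤ |c| * (1 + |d + b|) * |w - d| ^ (k + 1) := by
    intro c b w hw
    rw [add_sub_cancel_right, abs_mul, abs_mul, abs_pow, mul_right_comm]
    gcongr
    calc |w + b| = |(w - d) + (d + b)| := by congr 1; ring
      _ ≤ |w - d| + |d + b| := abs_add_le _ _
      _ ≤ _ := by gcongr
  refine ⟨max (|(-1) ^ k * (((k : ℝ) + 1) / d ^ (k + 1))| * (1 + |d + d / (k + 1)|))
    (|(-(((k : ℝ) + 1) / (1 - d) ^ (k + 1)))| * (1 + |d + (d - (k + 2)) / (k + 1)|)),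
    fun w hw => ?_⟩
  unfold mapPM
  split_ifs
  · exact (key _ _ w hw).trans (mul_le_mul_of_nonneg_right (le_max_left _ _) (by positivity))
  · exact (key _ _ w hw).trans (mul_le_mul_of_nonneg_right (le_max_right _ _) (by positivity))

theorem exists_abs_mapMOPPM_sub_le (r k : ℕ) :
    ∃ K θ, 0 ≤ K ∧ 0 < θ ∧ ∀ s < r, ∀ w, |w - idealWeight r s| ≤ θ →
      |mapMOPPM r k w - idealWeight r s| ≤ K * |w - idealWeight r s| ^ (k + 1) := by
  obtain ⟨γ, hγ, hgap⟩ := exists_idealWeight_gap r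
  obtain ⟨K, hK⟩ := exists_uniform_of_forall_lt r
    (p := fun s K => ∀ w, |w - idealWeight r s| ≤ 1 →
      |mapPM k (idealWeight r s) w - idealWeight r s| ≤ K * |w - idealWeight r s| ^ (k + 1))
    (fun _ _ _ h h' w hw => (h' w hw).trans (mul_le_mul_of_nonneg_right h (by positivity)))
    fun s _ => exists_abs_mapPM_sub_le k _
  -- Within `γ / 3` of `d_s`, the nearest ideal weight is within `2 * γ / 3 < γ` of `d_s`, hence
  -- equal to it.
  refine ⟨max K 0, min 1 (γ / 3), le_max_right _ _, by positivity, fun s hs w hw => ?_⟩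
  obtain ⟨h1, h2⟩ := nearestIndex_spec (r := r) (by omega) w
  have h3 : idealWeight r (nearestIndex r w) = idealWeight r s := by
    refine hgap _ h1 _ hs ?_
    have h4 := h2 s hs
    have h5 := hw.trans (min_le_right _ _)
    calc _ = |(w - idealWeight r s) - (w - idealWeight r (nearestIndex r w))| := by
          congr 1; ring
      _ ≤ |w - idealWeight r s| + |w - idealWeight r (nearestIndex r w)| := abs_sub _ _
      _ < γ := by linarith
  unfold mapMOPPM
  rw [h3]
  exact (hK s hs w (hw.trans (min_le_left _ _))).trans
    (mul_le_mul_of_nonneg_right (le_max_left _ _) (by positivity))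

/-- If the Jiang–Shu weights are within `θ` of the ideal ones, then the mapped weights sum to `1`
and are within `O(θ ^ (k + 1))` of the ideal ones. -/
theorem exists_abs_weightMOPPM_sub_le {r : ℕ} (hr : 0 < r) (k : ℕ) :
    ∃ K θ₀, 0 ≤ K ∧ 0 < θ₀ ∧ ∀ ε : ℝ, ∀ a : ℤ → ℝ, ∀ θ, 0 ≤ θ → θ ≤ θ₀ →
      (∀ s < r, |weightJS ε r s a - idealWeight r s| ≤ θ) →
      ∑ s ∈ range r, weightMOPPM ε r k s a = 1 ∧
      ∀ s < r, |weightMOPPM ε r k s a - idealWeight r s| ≤ K * θ ^ (k + 1) := by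
  obtain ⟨K, θ₁, hK, hθ₁, hmap⟩ := exists_abs_mapMOPPM_sub_le r k
  -- The last two bounds on `θ` give `r * η ≤ 1 / 2`, so the normalizing sum is at least `1 / 2`.
  refine ⟨2 * (K * (1 + r)), min θ₁ (min 1 (1 / (2 * (r * K + 1)))), by positivity, by positivity,
    fun ε a θ hθ hθ0 hw => ?_⟩
  set g : ℕ → ℝ := fun l => mapMOPPM r k (weightJS ε r l a)
  set η := K * θ ^ (k + 1) with hη
  have hη0 : 0 ≤ η := by positivity
  have hg : ∀ l < r, |g l - idealWeight r l| ≤ η := fun l hl => by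
    refine (hmap l hl _ ((hw l hl).trans (hθ0.trans (min_le_left _ _)))).trans ?_
    rw [hη]
    gcongr
    exact hw l hl
  have hθ1 : θ ≤ 1 := hθ0.trans ((min_le_right _ _).trans (min_le_left _ _))
  have hrη : r * η ≤ 1 / 2 := by
    have h1 : θ ^ (k + 1) ≤ θ := pow_le_of_le_one hθ hθ1 (by omega)
    have h2 : θ ≤ 1 / (2 * (r * K + 1)) := hθ0.trans ((min_le_right _ _).trans (min_le_right _ _))
    rw [le_div_iff₀ (by positivity)] at h2
    have h3 : r * η ≤ r * (K * θ) := by rw [hη]; gcongr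
    nlinarith
  set D := ∑ l ∈ range r, g l with hD
  have hD1 : |D - 1| ≤ r * η := by
    rw [hD, ← sum_idealWeight hr, ← Finset.sum_sub_distrib]
    refine (Finset.abs_sum_le_sum_abs _ _).trans ?_
    calc _ ≤ ∑ l ∈ range r, η := Finset.sum_le_sum fun l hl => hg l (Finset.mem_range.1 hl)
      _ = r * η := by simp
  have hDpos : 1 / 2 ≤ D := by
    have := (abs_le.1 hD1).1
    linarith
  constructor
  · change ∑ s ∈ range r, g s / D = 1
    rw [← Finset.sum_div, div_self (by linarith)]
  · intro s hs
    change |g s / D - idealWeight r s| ≤ _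
    rw [div_sub' (by linarith), abs_div, abs_of_pos (show 0 < D by linarith),
      div_le_iff₀ (by linarith), show g s - D * idealWeight r s
        = (g s - idealWeight r s) - idealWeight r s * (D - 1) by ring]
    refine (abs_sub _ _).trans ?_
    rw [abs_mul, abs_of_nonneg (idealWeight_nonneg r s)]
    have h1 : idealWeight r s * |D - 1| ≤ 1 * (r * η) :=
      mul_le_mul (idealWeight_le_one hs) hD1 (abs_nonneg _) zero_le_one
    have h2 : (1 / 2) * (2 * (η * (1 + r))) ≤ D * (2 * (η * (1 + r))) := by gcongr
    have h3 := hg s hs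
    rw [hη] at *
    linarith

/-! ### Weights and reconstruction for nearly polynomial averages -/

theorem iterate_derivative_eval_of_natDegree_le {Q : ℝ[X]} {n : ℕ} (hQ : Q.natDegree ≤ n) (x : ℝ) :
    (derivative^[n] Q).eval x = n.factorial * Q.coeff n := by
  have h0 : (derivative^[n] Q).natDegree ≤ 0 := by
    have := natDegree_iterate_derivative Q n
    omega
  rw [eq_C_of_natDegree_le_zero h0, eval_C, coeff_iterate_derivative, zero_add,
    Nat.descFactorial_self, nsmul_eq_mul]

theorem abs_eval_substencilPoly_sub_le {r s l : ℕ} {K η : ℝ} {a : ℤ → ℝ} {Q : ℝ[X]}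
    (hQ : Q.natDegree ≤ r) (ha : ∀ m : ℤ, |m| ≤ r → |a m - polyAverage Q m| ≤ η)
    (hK : ∀ (a : ℤ → ℝ) (η : ℝ), (∀ m : ℤ, |m| ≤ r → |a m| ≤ η) →
      ∀ ξ ∈ Set.Icc (-(1 / 2) : ℝ) (1 / 2),
        |(derivative^[l] (substencilPoly r s a)).eval ξ| ≤ K * η)
    {ξ : ℝ} (hξ : ξ ∈ Set.Icc (-(1 / 2) : ℝ) (1 / 2)) :
    |(derivative^[l] (substencilPoly r s a)).eval ξ - (derivative^[l + 1] Q).eval ξ| ≤ K * η := by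
  have h := hK (a - polyAverage Q) η ha ξ hξ
  rwa [substencilPoly_sub, substencilPoly_polyAverage s hQ, iterate_derivative_sub, eval_sub] at h

/-- If the averages are those of a polynomial of degree less than `r` up to `O(h ^ r)`, and the
`(n + 1)`-th derivative has exact size `h ^ (n + 1)`, then the Jiang–Shu weights are
`O(h ^ (r - 1 - n))`-close to the ideal ones. -/
theorem exists_abs_weightJS_sub_le {r n : ℕ} (hn : n + 2 ≤ r) {c C : ℝ} (hc : 0 < c)
    (hC : 0 ≤ C) :
    ∃ K H, 0 ≤ K ∧ 0 < H ∧ ∀ h, 0 < h → h < H → ∀ ε, 0 < ε → ∀ a : ℤ → ℝ,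
      (∃ Q : ℝ[X], Q.natDegree ≤ r ∧ ∀ m : ℤ, |m| ≤ r → |a m - polyAverage Q m| ≤ C * h ^ r) →
      (∃ Q : ℝ[X], Q.natDegree ≤ n + 2 ∧ c * h ^ (n + 1) ≤ |Q.coeff (n + 2)| ∧
        ∀ m : ℤ, |m| ≤ r → |a m - polyAverage Q m| ≤ C * h ^ (n + 2)) →
      ∀ s < r, |weightJS ε r s a - idealWeight r s| ≤ K * h ^ (r - 1 - n) := by
  obtain ⟨K₀, hK₀, hbound⟩ := exists_substencilPoly_bound r
  set c' := (c / 2) ^ 2 with hc'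
  set K₁ := (1 + 2 * r / c') * (2 * K₀ * C) with hK₁
  have hK₁0 : 0 ≤ K₁ := by positivity
  -- With this threshold each of the four summands times `h` is at most `1`, which yields all the
  -- smallness conditions below.
  refine ⟨6 * K₁, (1 + 2 * K₀ * C + 2 * K₀ * C / c + 6 * K₁)⁻¹, by positivity, by positivity,
    fun h hh hH ε hε a ⟨Q, hQ, haQ⟩ ⟨R, hR, hRc, haR⟩ s hs => ?_⟩
  rw [← one_div, lt_div_iff₀ (by positivity)] at hH
  have hp1 : 0 ≤ 2 * K₀ * C * h := by positivity
  have hp2 : 0 ≤ 2 * K₀ * C / c * h := by positivity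
  have hp3 : 0 ≤ K₁ * h := by positivity
  have hh1 : h ≤ 1 := by nlinarith
  have hH1 : 2 * K₀ * C * h ≤ 1 := by nlinarith
  have hH2 : K₀ * C * h ≤ c / 2 := by
    have : 2 * K₀ * C / c * h ≤ 1 := by nlinarith
    rw [div_mul_eq_mul_div, div_le_iff₀ hc] at this
    linarith
  have hH3 : K₁ * h ≤ 1 / 6 := by nlinarith
  have hpow : h ^ (r - 1 - n) ≤ h := pow_le_of_le_one hh.le hh1 (by omega)
  have hsplit : h ^ r = h ^ (r - 1 - n) * h ^ (n + 1) := by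
    rw [← pow_add]; congr 1; omega
  -- The summand `l = n + 1` suffices: that derivative of `p_t` is a constant of size at least `c *
  -- h ^ (n + 1)` up to `O(h ^ (n + 2))`.
  have hlower : ∀ t < r, c' * (h ^ (n + 1)) ^ 2 ≤ smoothness r t a := by
    intro t ht
    rw [hc', ← mul_pow]
    refine sq_le_smoothness (l := n + 1) (by omega) (by omega) t a (by positivity) fun ξ hξ => ?_
    have h1 := abs_eval_substencilPoly_sub_le (hR.trans hn) haR
      (hbound t ht (n + 1) (by omega)) hξ
    rw [iterate_derivative_eval_of_natDegree_le hR] at h1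
    have h2 : c * h ^ (n + 1) ≤ |((n + 2).factorial : ℝ) * R.coeff (n + 2)| := by
      rw [abs_mul, Nat.abs_cast]
      refine hRc.trans (le_mul_of_one_le_left (abs_nonneg _) ?_)
      exact_mod_cast Nat.one_le_iff_ne_zero.2 (Nat.factorial_ne_zero _)
    have h3 := abs_sub_abs_le_abs_sub (((n + 2).factorial : ℝ) * R.coeff (n + 2))
      ((derivative^[n + 1] (substencilPoly r t a)).eval ξ)
    rw [abs_sub_comm] at h3
    have h4 : K₀ * (C * h ^ (n + 2)) ≤ c / 2 * h ^ (n + 1) := by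
      calc _ = K₀ * C * h * h ^ (n + 1) := by ring
        _ ≤ _ := by gcongr
    linarith
  have hdiff : ∀ s < r, ∀ t < r,
      |smoothness r s a - smoothness r t a| ≤ (K₁ * h ^ (r - 1 - n)) * smoothness r t a := by
    intro s hs t ht
    have h1 := abs_smoothness_sub_le (δ := 2 * K₀ * C * h ^ r) (μ := h ^ (n + 1)) (c := c')
      (s := s) (t := t) (a := a) (r := r) (by positivity) ?_ (by positivity) (by positivity) ?_
      (hlower t ht)
    · refine h1.trans (le_of_eq ?_)
      rw [hsplit, hK₁]
      field_simp
    · rw [hsplit, ← mul_assoc]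
      refine mul_le_of_le_one_left (by positivity) (le_trans ?_ hH1)
      gcongr
    · intro l hl ξ hξ
      have h2 := abs_eval_substencilPoly_sub_le hQ haQ (hbound s hs l hl) hξ
      have h3 := abs_eval_substencilPoly_sub_le hQ haQ (hbound t ht l hl) hξ
      have h4 := abs_sub_le ((derivative^[l] (substencilPoly r s a)).eval ξ)
        ((derivative^[l + 1] Q).eval ξ) ((derivative^[l] (substencilPoly r t a)).eval ξ)
      rw [abs_sub_comm ((derivative^[l + 1] Q).eval ξ)] at h4
      linarith
  rw [mul_assoc]
  refine abs_weightJS_sub_le (by positivity) (le_trans ?_ hH3) hε hdiff hs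
  gcongr

theorem exists_abs_reconstruct_sub_le {r k n : ℕ} (hn : n + 2 ≤ r)
    (hk : r ≤ (r - 1 - n) * (k + 1)) {c C : ℝ} (hc : 0 < c) (hC : 0 ≤ C) :
    ∃ K H, 0 ≤ K ∧ 0 < H ∧ ∀ h, 0 < h → h < H → ∀ ε, 0 < ε → ∀ a : ℤ → ℝ,
      (∃ Q : ℝ[X], Q.natDegree ≤ r ∧ ∀ m : ℤ, |m| ≤ r → |a m - polyAverage Q m| ≤ C * h ^ r) →
      (∃ Q : ℝ[X], Q.natDegree ≤ n + 2 ∧ c * h ^ (n + 1) ≤ |Q.coeff (n + 2)| ∧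
        ∀ m : ℤ, |m| ≤ r → |a m - polyAverage Q m| ≤ C * h ^ (n + 2)) →
      |reconstruct ε r k a - idealReconstruct r a| ≤ K * h ^ (2 * r) := by
  obtain ⟨K₀, hK₀, hbound⟩ := exists_substencilPoly_bound r
  obtain ⟨K₁, H, hK₁, hH, hJS⟩ := exists_abs_weightJS_sub_le hn hc hC
  obtain ⟨K₂, θ₀, hK₂, hθ₀, hPM⟩ := exists_abs_weightMOPPM_sub_le (r := r) (by omega) k
  refine ⟨r * (K₂ * K₁ ^ (k + 1) * (K₀ * C)), min H (min 1 (θ₀ / (K₁ + 1))), by positivity,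
    by positivity, fun h hh hhH ε hε a hQ hR => ?_⟩
  have hw := hJS h hh (hhH.trans_le (min_le_left _ _)) ε hε a hQ hR
  have hh1 : h ≤ 1 := (hhH.trans_le ((min_le_right _ _).trans (min_le_left _ _))).le
  have hhθ := (hhH.trans_le ((min_le_right _ _).trans (min_le_right _ _))).le
  rw [le_div_iff₀ (by positivity)] at hhθ
  have hpow : h ^ (r - 1 - n) ≤ h := pow_le_of_le_one hh.le hh1 (by omega)
  obtain ⟨hsum, hclose⟩ := hPM ε a (K₁ * h ^ (r - 1 - n)) (by positivity)
    ((mul_le_mul_of_nonneg_left hpow hK₁).trans (by nlinarith)) hw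
  obtain ⟨Q, hQ, haQ⟩ := hQ
  -- Both families of weights sum to one, so a common value may be subtracted from all the
  -- substencil values; each term is then a product of two `O(h ^ r)` factors.
  have h1 : reconstruct ε r k a - idealReconstruct r a
      = ∑ s ∈ range r, (weightMOPPM ε r k s a - idealWeight r s) *
        (substencilValue r s a - (derivative Q).eval (1 / 2)) := by
    unfold reconstruct idealReconstruct
    simp only [mul_sub, sub_mul, Finset.sum_sub_distrib, ← Finset.sum_mul, hsum,
      sum_idealWeight (r := r) (by omega)]
    ring
  rw [h1]
  refine (Finset.abs_sum_le_sum_abs _ _).trans ?_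
  calc _ ≤ ∑ s ∈ range r, K₂ * K₁ ^ (k + 1) * (K₀ * C) * h ^ (2 * r) := by
        refine Finset.sum_le_sum fun s hs => ?_
        have hs' := Finset.mem_range.1 hs
        have h2 : |substencilValue r s a - (derivative Q).eval (1 / 2)| ≤ K₀ * (C * h ^ r) :=
          abs_eval_substencilPoly_sub_le (l := 0) hQ haQ (hbound s hs' 0 (by omega))
            (by norm_num)
        have h3 : K₂ * (K₁ * h ^ (r - 1 - n)) ^ (k + 1) ≤ K₂ * K₁ ^ (k + 1) * h ^ r := by
          rw [mul_pow, ← pow_mul, ← mul_assoc]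
          exact mul_le_mul_of_nonneg_left (pow_le_pow_of_le_one hh.le hh1 hk) (by positivity)
        rw [abs_mul]
        calc _ ≤ (K₂ * K₁ ^ (k + 1) * h ^ r) * (K₀ * (C * h ^ r)) :=
              mul_le_mul ((hclose s hs').trans h3) h2 (abs_nonneg _) (by positivity)
          _ = _ := by ring
    _ = _ := by
        rw [Finset.sum_const, Finset.card_range, nsmul_eq_mul]
        ring

/-! ### Taylor expansion of the cell averages -/

theorem differentiableAt_iteratedDeriv_of_contDiffAt {u : ℝ → ℝ} {x : ℝ} {N m : ℕ}
    (h : ContDiffAt ℝ N u x) (hm : m < N) : DifferentiableAt ℝ (iteratedDeriv m u) x := by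
  rw [iteratedDeriv_eq_equiv_comp]
  exact (LinearIsometryEquiv.differentiableAt _).comp x
    (h.differentiableAt_iteratedFDeriv (by exact_mod_cast hm))

theorem sum_taylor_sub_le {u : ℝ → ℝ} {s : Set ℝ} (hs : Convex ℝ s) {N : ℕ} (hN : 0 < N) {M : ℝ}
    (hu : ∀ y ∈ s, ContDiffAt ℝ N u y) (hM : ∀ y ∈ s, |iteratedDeriv N u y| ≤ M) {x y : ℝ}
    (hx : x ∈ s) (hy : y ∈ s) :
    |u y - ∑ i ∈ range N, iteratedDeriv i u x / i.factorial * (y - x) ^ i| ≤ M * |y - x| ^ N := by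
  have hM0 : 0 ≤ M := (abs_nonneg _).trans (hM x hx)
  obtain ⟨n, rfl⟩ := Nat.exists_eq_succ_of_ne_zero hN.ne'
  rw [Nat.succ_eq_add_one] at *
  rcases eq_or_ne x y with rfl | hxy
  · rw [Finset.sum_range_succ']
    simp
  have hsub : Set.uIcc x y ⊆ s := hs.ordConnected.uIcc_subset hx hy
  have hcd : ContDiffOn ℝ (n + 1 : ℕ) u (Set.uIcc x y) :=
    fun z hz => (hu z (hsub hz)).contDiffWithinAt
  obtain ⟨z, hz, hzeq⟩ := taylor_mean_remainder_lagrange_iteratedDeriv hxy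
    (by exact_mod_cast hcd)
  have h1 : taylorWithinEval u n (Set.uIcc x y) x y
      = ∑ i ∈ range (n + 1), iteratedDeriv i u x / i.factorial * (y - x) ^ i := by
    rw [taylor_within_apply]
    refine Finset.sum_congr rfl fun i hi => ?_
    have hi' := Finset.mem_range.1 hi
    rw [iteratedDerivWithin_eq_iteratedDeriv (uniqueDiffOn_uIcc hxy)
      ((hu x hx).of_le (by exact_mod_cast hi'.le)) Set.left_mem_uIcc, smul_eq_mul]
    ring
  rw [← h1, hzeq, abs_div, abs_mul, abs_pow, Nat.abs_cast]
  have hz' : z ∈ s := hsub (Set.Ioo_subset_Icc_self hz)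
  refine (div_le_self (by positivity) ?_).trans
    (mul_le_mul_of_nonneg_right (hM z hz') (by positivity))
  exact_mod_cast Nat.one_le_iff_ne_zero.2 (Nat.factorial_ne_zero _)

/-- The averages over the cells of the mesh with centre `y` and signed cell size `H`. -/
def signedAverage (u : ℝ → ℝ) (y H : ℝ) (m : ℤ) : ℝ :=
  ∫ ξ in (m - 1 / 2 : ℝ)..(m + 1 / 2), u (y + H * ξ)

theorem cellAverage_eq_signedAverage (u : ℝ → ℝ) (x : ℝ) {h : ℝ} (hh : h ≠ 0) (i m : ℤ) :
    cellAverage u x h (i + m) = signedAverage u (x + i * h) h m := by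
  unfold cellAverage signedAverage
  rw [intervalIntegral.integral_comp_add_mul u hh, smul_eq_mul, div_eq_inv_mul]
  congr 2 <;> (push_cast; ring)

/-- Reflection is a change of sign of the cell size, so every estimate for signed sizes covers `u^+`
as well as `u^-`. -/
theorem cellAverage_eq_signedAverage_neg (u : ℝ → ℝ) (x : ℝ) {h : ℝ} (hh : h ≠ 0) (i m : ℤ) :
    cellAverage u x h (i - m) = signedAverage u (x + i * h) (-h) m := by
  unfold cellAverage signedAverage
  rw [intervalIntegral.integral_comp_add_mul u (neg_ne_zero.2 hh), smul_eq_mul, div_eq_inv_mul,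
    intervalIntegral.integral_symm, inv_neg, mul_neg, neg_mul]
  congr 3 <;> (push_cast; ring)

/-- A primitive of the Taylor polynomial, of degree less than `N`, of `ξ ↦ u (y + H * ξ)`. -/
def taylorPrimitive (u : ℝ → ℝ) (y H : ℝ) (N : ℕ) : ℝ[X] :=
  ∑ i ∈ range N, C (iteratedDeriv i u y / i.factorial * H ^ i / (i + 1)) * X ^ (i + 1)

theorem natDegree_taylorPrimitive_le (u : ℝ → ℝ) (y H : ℝ) (N : ℕ) :
    (taylorPrimitive u y H N).natDegree ≤ N := by
  refine natDegree_sum_le_of_forall_le _ _ fun i hi => ?_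
  exact (natDegree_C_mul_X_pow_le _ _).trans (Finset.mem_range.1 hi)

theorem coeff_taylorPrimitive (u : ℝ → ℝ) (y H : ℝ) (N : ℕ) :
    (taylorPrimitive u y H (N + 1)).coeff (N + 1)
      = iteratedDeriv N u y / N.factorial * H ^ N / (N + 1) := by
  unfold taylorPrimitive
  rw [Finset.sum_range_succ, coeff_add, coeff_C_mul_X_pow, if_pos rfl,
    coeff_eq_zero_of_natDegree_lt, zero_add]
  exact Nat.lt_succ_of_le (natDegree_taylorPrimitive_le u y H N)

theorem eval_derivative_taylorPrimitive (u : ℝ → ℝ) (y H : ℝ) (N : ℕ) (ξ : ℝ) :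
    (derivative (taylorPrimitive u y H N)).eval ξ
      = ∑ i ∈ range N, iteratedDeriv i u y / i.factorial * (y + H * ξ - y) ^ i := by
  unfold taylorPrimitive
  rw [derivative_sum, eval_finsetSum]
  refine Finset.sum_congr rfl fun i _ => ?_
  rw [derivative_C_mul_X_pow, eval_C_mul, eval_pow, eval_X, add_sub_cancel_left, mul_pow,
    Nat.add_sub_cancel]
  push_cast
  have : (i : ℝ) + 1 ≠ 0 := by positivity
  field_simp

theorem polyAverage_eq_integral (Q : ℝ[X]) (m : ℤ) :
    polyAverage Q m = ∫ ξ in (m - 1 / 2 : ℝ)..(m + 1 / 2), (derivative Q).eval ξ :=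
  (intervalIntegral.integral_eq_sub_of_hasDerivAt (fun ξ _ => Q.hasDerivAt ξ)
    ((derivative Q).continuous.intervalIntegrable _ _)).symm

/-- Bounds for the derivatives of order at most `N` of `u` on a set. -/
structure DerivBound (u : ℝ → ℝ) (N : ℕ) (M : ℝ) (s : Set ℝ) : Prop where
  contDiffAt : ∀ y ∈ s, ContDiffAt ℝ N u y
  bound : ∀ i ≤ N, ∀ y ∈ s, |iteratedDeriv i u y| ≤ M

theorem DerivBound.abs_sub_taylor_le {u : ℝ → ℝ} {N n : ℕ} {M : ℝ} {s : Set ℝ}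
    (h : DerivBound u N M s) (hs : Convex ℝ s) (hn : 0 < n) (hnN : n ≤ N) {y H ξ : ℝ} (hy : y ∈ s)
    (hξ : y + H * ξ ∈ s) :
    |u (y + H * ξ) - (derivative (taylorPrimitive u y H n)).eval ξ|
      ≤ M * |ξ| ^ n * |H| ^ n := by
  rw [eval_derivative_taylorPrimitive]
  refine (sum_taylor_sub_le hs hn (fun z hz => (h.contDiffAt z hz).of_le (by exact_mod_cast hnN))
    (h.bound n hnN) hy hξ).trans (le_of_eq ?_)
  rw [add_sub_cancel_left, abs_mul, mul_pow]
  ring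

theorem DerivBound.abs_signedAverage_sub_le {u : ℝ → ℝ} {N n r : ℕ} {M : ℝ} {s : Set ℝ}
    (h : DerivBound u N M s) (hs : Convex ℝ s) (hn : 0 < n) (hnN : n ≤ N) {y H : ℝ}
    (hy : ∀ ξ : ℝ, |ξ| ≤ r + 1 → y + H * ξ ∈ s) {m : ℤ} (hm : |m| ≤ r) :
    |signedAverage u y H m - polyAverage (taylorPrimitive u y H n) m|
      ≤ M * (r + 1) ^ n * |H| ^ n := by
  have hm' : |(m : ℝ)| ≤ r := by exact_mod_cast hm
  obtain ⟨hm1, hm2⟩ := abs_le.1 hm'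
  have hle : (m - 1 / 2 : ℝ) ≤ m + 1 / 2 := by linarith
  have hys : y ∈ s := by simpa using hy 0 (by rw [abs_zero]; positivity)
  have hM0 : 0 ≤ M := (abs_nonneg _).trans (h.bound 0 (Nat.zero_le _) y hys)
  have hmem : ∀ ξ ∈ Set.uIcc (m - 1 / 2 : ℝ) (m + 1 / 2), |ξ| ≤ r + 1 := by
    intro ξ hξ
    rw [Set.uIcc_of_le hle] at hξ
    rw [abs_le]
    constructor <;> linarith [hξ.1, hξ.2]
  have hint : IntervalIntegrable (fun ξ => u (y + H * ξ)) MeasureTheory.volume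
      (m - 1 / 2 : ℝ) (m + 1 / 2) := by
    refine ContinuousOn.intervalIntegrable fun ξ hξ => ContinuousAt.continuousWithinAt ?_
    exact ContinuousAt.comp (f := fun ξ => y + H * ξ)
      (h.contDiffAt _ (hy ξ (hmem ξ hξ))).continuousAt (by fun_prop)
  rw [polyAverage_eq_integral, signedAverage, ← intervalIntegral.integral_sub hint
    ((derivative (taylorPrimitive u y H n)).continuous.intervalIntegrable _ _)]
  have := intervalIntegral.norm_integral_le_of_norm_le_const (a := (m - 1 / 2 : ℝ))
    (b := m + 1 / 2) (C := M * (r + 1) ^ n * |H| ^ n)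
    (f := fun ξ => u (y + H * ξ) - (derivative (taylorPrimitive u y H n)).eval ξ) ?_
  · rw [show (m + 1 / 2 : ℝ) - (m - 1 / 2) = 1 by ring, abs_one, mul_one] at this
    exact this
  · intro ξ hξ
    have hξ' := hmem ξ (Set.uIoc_subset_uIcc hξ)
    refine (h.abs_sub_taylor_le hs hn hnN hys (hy ξ hξ')).trans ?_
    gcongr

theorem exists_derivBound {u : ℝ → ℝ} {xc : ℝ} (hu : ContDiffAt ℝ ∞ u xc) (N n : ℕ)
    (hn : iteratedDeriv n u xc ≠ 0) :
    ∃ δ M c, 0 < δ ∧ 0 ≤ M ∧ 0 < c ∧ DerivBound u N M (Metric.ball xc δ) ∧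
      ∀ y ∈ Metric.ball xc δ, c ≤ |iteratedDeriv n u y| := by
  have hcont : ∀ i : ℕ, ContinuousAt (fun y => |iteratedDeriv i u y|) xc := fun i =>
    (differentiableAt_iteratedDeriv_of_contDiffAt (N := i + 1)
      (hu.of_le (by exact_mod_cast le_top)) (by omega)).continuousAt.abs
  have h1 : ∀ᶠ y in nhds xc, ContDiffAt ℝ N u y :=
    (hu.of_le (by exact_mod_cast le_top)).eventually (by simp)
  have h2 : ∀ᶠ y in nhds xc, |iteratedDeriv n u xc| / 2 < |iteratedDeriv n u y| :=
    (hcont n).eventually_const_lt (half_lt_self (abs_pos.2 hn))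
  have h3 : ∀ᶠ y in nhds xc, ∀ i ∈ range (N + 1),
      |iteratedDeriv i u y| < |iteratedDeriv i u xc| + 1 := by
    rw [Finset.eventually_all]
    exact fun i _ => (hcont i).eventually_lt_const (lt_add_one _)
  obtain ⟨δ, hδ, hball⟩ := Metric.eventually_nhds_iff_ball.1 (h1.and (h2.and h3))
  refine ⟨δ, ∑ i ∈ range (N + 1), (|iteratedDeriv i u xc| + 1), |iteratedDeriv n u xc| / 2, hδ,
    by positivity, half_pos (abs_pos.2 hn), ⟨fun y hy => (hball y hy).1, fun i hi y hy => ?_⟩,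
    fun y hy => (hball y hy).2.1.le⟩
  have hi' : i ∈ range (N + 1) := Finset.mem_range.2 (by omega)
  exact ((hball y hy).2.2 i hi').le.trans (Finset.single_le_sum
    (f := fun i => |iteratedDeriv i u xc| + 1) (fun _ _ => by positivity) hi')

theorem DerivBound.abs_iteratedDeriv_sub_le {u : ℝ → ℝ} {N n : ℕ} {M : ℝ} {s : Set ℝ}
    (h : DerivBound u N M s) (hs : Convex ℝ s) (hn : n < N) {y y' : ℝ} (hy : y ∈ s)
    (hy' : y' ∈ s) : |iteratedDeriv n u y - iteratedDeriv n u y'| ≤ M * |y - y'| := by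
  refine hs.norm_image_sub_le_of_norm_deriv_le
    (fun z hz => differentiableAt_iteratedDeriv_of_contDiffAt (h.contDiffAt z hz) hn)
    (fun z hz => ?_) hy' hy
  rw [← iteratedDeriv_succ]
  exact h.bound (n + 1) hn z hz

/-! ### Leading term of the reconstruction error -/

theorem idealReconstruct_sub (r : ℕ) (a b : ℤ → ℝ) :
    idealReconstruct r (a - b) = idealReconstruct r a - idealReconstruct r b := by
  simp only [idealReconstruct, substencilValue, substencilPoly_sub, eval_sub, mul_sub,
    Finset.sum_sub_distrib]

theorem idealReconstruct_smul (r : ℕ) (c : ℝ) (a : ℤ → ℝ) :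
    idealReconstruct r (c • a) = c * idealReconstruct r a := by
  have h : ∀ s, primitiveValue r s (c • a) = c • primitiveValue r s a := by
    intro s
    ext i
    simp [primitiveValue, Finset.mul_sum]
  simp only [idealReconstruct, substencilValue, substencilPoly, h, map_smul,
    eval_smul, smul_eq_mul, Finset.mul_sum]
  exact Finset.sum_congr rfl fun _ _ => by ring

theorem exists_abs_idealReconstruct_le {r : ℕ} (hr : 0 < r) :
    ∃ K, 0 ≤ K ∧ ∀ (a : ℤ → ℝ) (η : ℝ), (∀ m : ℤ, |m| ≤ r → |a m| ≤ η) →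
      |idealReconstruct r a| ≤ K * η := by
  obtain ⟨K, hK, hbound⟩ := exists_substencilPoly_bound r
  refine ⟨K, hK, fun a η ha => ?_⟩
  refine (Finset.abs_sum_le_sum_abs _ _).trans ?_
  calc _ ≤ ∑ s ∈ range r, idealWeight r s * (K * η) := by
        refine Finset.sum_le_sum fun s hs => ?_
        rw [abs_mul, abs_of_nonneg (idealWeight_nonneg r s)]
        exact mul_le_mul_of_nonneg_left
          (hbound s (Finset.mem_range.1 hs) 0 hr a η ha (1 / 2) (by norm_num))
          (idealWeight_nonneg r s)
    _ = K * η := by rw [← Finset.sum_mul, sum_idealWeight hr, one_mul]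

theorem polyAverage_sub_C_mul (Q R : ℝ[X]) (c : ℝ) :
    polyAverage (Q - C c * R) = polyAverage Q - c • polyAverage R := by
  ext m
  simp only [polyAverage, eval_sub, eval_mul, eval_C, Pi.sub_apply, Pi.smul_apply, smul_eq_mul]
  ring

/-- The ideal reconstruction is exact on the Taylor primitive without its top term `κ * X ^ (2 *
r)`, so the leading error is `κ` times the error `e` on the monomial. As `e` depends on `r` only,
the coefficient `c` is the same for all cells. -/
theorem DerivBound.exists_abs_idealReconstruct_sub_le {r : ℕ} (hr : 0 < r) {u : ℝ → ℝ} {M : ℝ}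
    {s : Set ℝ} (h : DerivBound u (2 * r) M s) (hs : Convex ℝ s) (hM : 0 ≤ M) :
    ∃ K c, 0 ≤ K ∧ ∀ y H : ℝ, (∀ ξ : ℝ, |ξ| ≤ r + 1 → y + H * ξ ∈ s) →
      |idealReconstruct r (signedAverage u y H) - u (y + H * (1 / 2))
        - c * iteratedDeriv (2 * r - 1) u y * H ^ (2 * r - 1)| ≤ K * |H| ^ (2 * r) := by
  obtain ⟨K, hK, hbound⟩ := exists_abs_idealReconstruct_le hr
  set e := idealReconstruct r (polyAverage (X ^ (2 * r)))
    - (derivative (X ^ (2 * r) : ℝ[X])).eval (1 / 2) with he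
  refine ⟨K * (M * (r + 1) ^ (2 * r)) + M * |(1 / 2 : ℝ)| ^ (2 * r),
    e / ((2 * r - 1).factorial * ((2 * r - 1 : ℕ) + 1)), by positivity, fun y H hy => ?_⟩
  have hys : y ∈ s := by simpa using hy 0 (by rw [abs_zero]; positivity)
  set Q := taylorPrimitive u y H (2 * r) with hQ
  set Q' := taylorPrimitive u y H (2 * r - 1) with hQ'
  set κ := iteratedDeriv (2 * r - 1) u y / (2 * r - 1).factorial * H ^ (2 * r - 1)
    / ((2 * r - 1 : ℕ) + 1) with hκ
  have hQQ' : Q' = Q - C κ * X ^ (2 * r) := by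
    rw [hQ, hQ', taylorPrimitive, taylorPrimitive]
    conv_rhs => rw [show 2 * r = 2 * r - 1 + 1 by omega, Finset.sum_range_succ]
    rw [hκ, Nat.sub_add_cancel (by omega : 1 ≤ 2 * r)]
    ring
  have h1 := idealReconstruct_polyAverage hr (natDegree_taylorPrimitive_le u y H (2 * r - 1))
  rw [← hQ', hQQ', polyAverage_sub_C_mul, idealReconstruct_sub, idealReconstruct_smul,
    derivative_sub, derivative_C_mul, eval_sub, eval_C_mul] at h1
  have h2 := hbound (signedAverage u y H - polyAverage Q) (M * (r + 1) ^ (2 * r) * |H| ^ (2 * r))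
    fun m hm => h.abs_signedAverage_sub_le hs (by omega) le_rfl hy hm
  rw [idealReconstruct_sub] at h2
  have h3 := h.abs_sub_taylor_le hs (n := 2 * r) (by omega) le_rfl hys
    (hy (1 / 2) (by rw [abs_of_pos (by norm_num)]; linarith [(Nat.cast_nonneg r : (0 : ℝ) ≤ r)]))
  have h4 : e / ((2 * r - 1).factorial * ((2 * r - 1 : ℕ) + 1)) * iteratedDeriv (2 * r - 1) u y
      * H ^ (2 * r - 1) = κ * e := by
    rw [hκ]
    field_simp
  rw [h4]
  calc _ = |(idealReconstruct r (signedAverage u y H) - idealReconstruct r (polyAverage Q))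
        - (u (y + H * (1 / 2)) - (derivative Q).eval (1 / 2))| := by
        congr 1
        rw [he]
        linear_combination h1
    _ ≤ _ := (abs_sub _ _).trans (add_le_add h2 h3)
    _ = _ := by ring

/-- The reconstruction error at the right end of a cell with centre `y` and signed size `H`. -/
def reconstructError (ε : ℝ) (r k : ℕ) (u : ℝ → ℝ) (y H : ℝ) : ℝ :=
  reconstruct ε r k (signedAverage u y H) - u (y + H * (1 / 2))

/-- The second bound gains a power of `|H|`: the leading terms at `y` and `y'` share their
coefficient, and `u^(2r-1)` is Lipschitz. -/
theorem DerivBound.exists_abs_reconstructError_le {r k n : ℕ} (hn : n + 2 ≤ r)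
    (hk : r ≤ (r - 1 - n) * (k + 1)) {u : ℝ → ℝ} {M c : ℝ} {s : Set ℝ}
    (h : DerivBound u (2 * r) M s) (hs : Convex ℝ s) (hM : 0 ≤ M) (hc : 0 < c)
    (hu : ∀ y ∈ s, c ≤ |iteratedDeriv (n + 1) u y|) :
    ∃ K h₀, 0 ≤ K ∧ 0 < h₀ ∧ ∀ ε, 0 < ε → ∀ H : ℝ, 0 < |H| → |H| < h₀ →
      ∀ y, (∀ ξ : ℝ, |ξ| ≤ r + 1 → y + H * ξ ∈ s) →
        |reconstructError ε r k u y H| ≤ K * |H| ^ (2 * r - 1) ∧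
        ∀ y', (∀ ξ : ℝ, |ξ| ≤ r + 1 → y' + H * ξ ∈ s) → |y - y'| ≤ |H| →
          |reconstructError ε r k u y H - reconstructError ε r k u y' H| ≤ K * |H| ^ (2 * r) := by
  obtain ⟨K₁, b, hK₁, hlin⟩ := h.exists_abs_idealReconstruct_sub_le (r := r) (by omega) hs hM
  set C₀ := M * (r + 1) ^ r with hC₀
  -- The denominator is that of the top coefficient of `taylorPrimitive u y H (n + 2)`.
  set c₀ := c / ((n + 1).factorial * ((n + 1 : ℕ) + 1)) with hc₀
  obtain ⟨K₂, h₁, hK₂, hh₁, hnl⟩ := exists_abs_reconstruct_sub_le (k := k) hn hk (c := c₀) (C := C₀)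
    (by positivity) (by positivity)
  have hE : ∀ ε, 0 < ε → ∀ H : ℝ, 0 < |H| → |H| < h₁ → ∀ y,
      (∀ ξ : ℝ, |ξ| ≤ r + 1 → y + H * ξ ∈ s) → |reconstructError ε r k u y H
        - b * iteratedDeriv (2 * r - 1) u y * H ^ (2 * r - 1)| ≤ (K₁ + K₂) * |H| ^ (2 * r) := by
    intro ε hε H hH hH1 y hy
    have hys : y ∈ s := by simpa using hy 0 (by rw [abs_zero]; positivity)
    have h1 := hlin y H hy
    have h2 := hnl |H| hH hH1 ε hε (signedAverage u y H)
      ⟨taylorPrimitive u y H r, natDegree_taylorPrimitive_le _ _ _ _, fun m hm =>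
        h.abs_signedAverage_sub_le hs (by omega) (by omega) hy hm⟩
      ⟨taylorPrimitive u y H (n + 2), natDegree_taylorPrimitive_le _ _ _ _, ?_, fun m hm => ?_⟩
    · calc _ = |(reconstruct ε r k (signedAverage u y H)
              - idealReconstruct r (signedAverage u y H))
            + (idealReconstruct r (signedAverage u y H) - u (y + H * (1 / 2))
              - b * iteratedDeriv (2 * r - 1) u y * H ^ (2 * r - 1))| := by
            unfold reconstructError
            congr 1
            ring
        _ ≤ _ := (abs_add_le _ _).trans (add_le_add h2 h1)
        _ = _ := by ring
    · rw [coeff_taylorPrimitive, abs_div, abs_mul, abs_div, Nat.abs_cast, abs_pow,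
        abs_of_nonneg (by positivity : (0 : ℝ) ≤ ((n + 1 : ℕ) : ℝ) + 1)]
      calc c₀ * |H| ^ (n + 1)
          = c / (n + 1).factorial * |H| ^ (n + 1) / ((n + 1 : ℕ) + 1) := by
            rw [hc₀]
            field_simp
        _ ≤ _ := by
            gcongr
            exact hu y hys
    · refine (h.abs_signedAverage_sub_le hs (by omega) (by omega) hy hm).trans ?_
      rw [hC₀]
      gcongr
      linarith [(Nat.cast_nonneg r : (0 : ℝ) ≤ r)]
  have hsucc : ∀ H : ℝ, |H| ^ (2 * r) = |H| * |H| ^ (2 * r - 1) := fun H => by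
    rw [← pow_succ', Nat.sub_add_cancel (by omega : 1 ≤ 2 * r)]
  refine ⟨2 * (K₁ + K₂) + |b| * M, min 1 h₁, by positivity, by positivity,
    fun ε hε H hH hH1 y hy => ⟨?_, fun y' hy' hyy' => ?_⟩⟩
  · have hys : y ∈ s := by simpa using hy 0 (by rw [abs_zero]; positivity)
    have h1 := hE ε hε H hH (hH1.trans_le (min_le_right _ _)) y hy
    have h2 : |b * iteratedDeriv (2 * r - 1) u y * H ^ (2 * r - 1)|
        ≤ |b| * M * |H| ^ (2 * r - 1) := by
      rw [abs_mul, abs_mul, abs_pow]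
      gcongr
      exact h.bound _ (by omega) y hys
    have h3 : |H| ^ (2 * r) ≤ |H| ^ (2 * r - 1) := by
      rw [hsucc]
      exact mul_le_of_le_one_left (by positivity) (hH1.trans_le (min_le_left _ _)).le
    have h4 := abs_sub_abs_le_abs_sub (reconstructError ε r k u y H)
      (b * iteratedDeriv (2 * r - 1) u y * H ^ (2 * r - 1))
    have h5 : 0 ≤ (K₁ + K₂) * |H| ^ (2 * r - 1) := by positivity
    have h6 := mul_le_mul_of_nonneg_left h3 (add_nonneg hK₁ hK₂)
    linarith
  · have hys : y ∈ s := by simpa using hy 0 (by rw [abs_zero]; positivity)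
    have hys' : y' ∈ s := by simpa using hy' 0 (by rw [abs_zero]; positivity)
    have h1 := hE ε hε H hH (hH1.trans_le (min_le_right _ _)) y hy
    have h2 := hE ε hε H hH (hH1.trans_le (min_le_right _ _)) y' hy'
    have h3 : |b * (iteratedDeriv (2 * r - 1) u y - iteratedDeriv (2 * r - 1) u y')
        * H ^ (2 * r - 1)| ≤ |b| * M * |H| ^ (2 * r) := by
      rw [abs_mul, abs_mul, abs_pow, hsucc, mul_assoc |b| M, ← mul_assoc M, ← mul_assoc]
      gcongr
      exact (h.abs_iteratedDeriv_sub_le hs (by omega) hys hys').trans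
        (mul_le_mul_of_nonneg_left hyy' hM)
    rw [abs_le] at *
    constructor <;> nlinarith

end Reconstruction

/-! ### From reconstruction errors to the truncation error -/

/-- Pass through `f (u₂ + e₁)`. The mean value theorem for `t ↦ f (t + e₁) - f t`, whose derivative
is at most `L * |e₁|`, handles the change of base point; the Lipschitz bound for `f` handles the
change of increment. -/
theorem exists_abs_increment_sub_le {f : ℝ → ℝ} (hf : ContDiff ℝ 2 f) (R : ℝ) :
    ∃ L, 0 ≤ L ∧ ∀ u₁ e₁ u₂ e₂ : ℝ, |u₁| ≤ R → |e₁| ≤ R → |u₂| ≤ R → |e₂| ≤ R →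
      |(f (u₁ + e₁) - f u₁) - (f (u₂ + e₂) - f u₂)| ≤ L * (|e₁| * |u₁ - u₂| + |e₁ - e₂|) := by
  have hf' : ContDiff ℝ 1 (deriv f) := by
    rw [show (2 : WithTop ℕ∞) = 1 + 1 by norm_num] at hf
    exact (contDiff_succ_iff_deriv.1 hf).2.2
  have hd : Differentiable ℝ f := hf.differentiable (by norm_num)
  have hd' : Differentiable ℝ (deriv f) := hf'.differentiable (by norm_num)
  obtain ⟨L₁, hL₁⟩ := (isCompact_Icc (a := -(2 * R)) (b := 2 * R)).exists_bound_of_continuousOn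
    hf'.continuous.continuousOn
  obtain ⟨L₂, hL₂⟩ := (isCompact_Icc (a := -(2 * R)) (b := 2 * R)).exists_bound_of_continuousOn
    (hf'.continuous_deriv le_rfl).continuousOn
  refine ⟨max 0 (max L₁ L₂), le_max_left _ _, fun u₁ e₁ u₂ e₂ hu₁ he₁ hu₂ he₂ => ?_⟩
  set L := max 0 (max L₁ L₂)
  have hL1 : L₁ ≤ L := (le_max_left _ _).trans (le_max_right _ _)
  have hL2 : L₂ ≤ L := (le_max_right _ _).trans (le_max_right _ _)
  rw [abs_le] at hu₁ he₁ hu₂ he₂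
  have h1 : ∀ x ∈ Set.Icc (-(2 * R)) (2 * R), ∀ y ∈ Set.Icc (-(2 * R)) (2 * R),
      |f x - f y| ≤ L * |x - y| := fun x hx y hy =>
    (convex_Icc _ _).norm_image_sub_le_of_norm_deriv_le (fun z _ => hd z)
      (fun z hz => (hL₁ z hz).trans hL1) hy hx
  have h2 : ∀ x ∈ Set.Icc (-(2 * R)) (2 * R), ∀ y ∈ Set.Icc (-(2 * R)) (2 * R),
      |deriv f x - deriv f y| ≤ L * |x - y| := fun x hx y hy =>
    (convex_Icc _ _).norm_image_sub_le_of_norm_deriv_le (fun z _ => hd' z)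
      (fun z hz => (hL₂ z hz).trans hL2) hy hx
  have h3 : |(f (u₁ + e₁) - f u₁) - (f (u₂ + e₁) - f u₂)| ≤ L * |e₁| * |u₁ - u₂| := by
    refine (convex_Icc (-R) R).norm_image_sub_le_of_norm_hasDerivWithin_le
      (f := fun t => f (t + e₁) - f t) (f' := fun t => deriv f (t + e₁) - deriv f t)
      (fun t _ => (((hd _).hasDerivAt.comp_add_const t e₁).sub
        (hd t).hasDerivAt).hasDerivWithinAt) (fun t ht => ?_) ⟨hu₂.1, hu₂.2⟩ ⟨hu₁.1, hu₁.2⟩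
    have h4 := h2 (t + e₁) ⟨by linarith [ht.1], by linarith [ht.2]⟩ t
      ⟨by linarith [ht.1, ht.2], by linarith [ht.1, ht.2]⟩
    rwa [add_sub_cancel_left] at h4
  have h5 := h1 (u₂ + e₁) ⟨by linarith, by linarith⟩ (u₂ + e₂) ⟨by linarith, by linarith⟩
  rw [add_sub_add_left_eq_sub] at h5
  calc _ = |((f (u₁ + e₁) - f u₁) - (f (u₂ + e₁) - f u₂)) + (f (u₂ + e₁) - f (u₂ + e₂))| := by
        congr 1; ring
    _ ≤ _ := (abs_add_le _ _).trans (add_le_add h3 h5)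
    _ = _ := by ring

theorem leftValue_cellAverage (ε : ℝ) (r k : ℕ) (u : ℝ → ℝ) (x : ℝ) {h : ℝ} (hh : h ≠ 0) (i : ℤ) :
    leftValue ε r k (cellAverage u x h) i
      = u (x + i * h + h * (1 / 2)) + reconstructError ε r k u (x + i * h) h := by
  unfold leftValue reconstructError
  rw [add_sub_cancel]
  congr 1
  ext m
  exact cellAverage_eq_signedAverage u x hh i m

theorem rightValue_cellAverage (ε : ℝ) (r k : ℕ) (u : ℝ → ℝ) (x : ℝ) {h : ℝ} (hh : h ≠ 0) (i : ℤ) :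
    rightValue ε r k (cellAverage u x h) i
      = u (x + i * h + h * (1 / 2)) + reconstructError ε r k u (x + (i + 1 : ℤ) * h) (-h) := by
  unfold rightValue reconstructError
  rw [show x + (i + 1 : ℤ) * h + -h * (1 / 2) = x + i * h + h * (1 / 2) by push_cast; ring,
    add_sub_cancel]
  congr 1
  ext m
  exact cellAverage_eq_signedAverage_neg u x hh (i + 1) m

theorem abs_spatialOperator_sub_le {f : ℝ → ℝ} {α ε h L A B : ℝ} {r k : ℕ} {u : ℝ → ℝ} {x : ℝ}
    (hh : 0 < h) {l₀ l₁ r₀ r₁ : ℝ}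
    (hl₀ : leftValue ε r k (cellAverage u x h) 0 = u (x + h / 2) + l₀)
    (hl₁ : leftValue ε r k (cellAverage u x h) (-1) = u (x - h / 2) + l₁)
    (hr₀ : rightValue ε r k (cellAverage u x h) 0 = u (x + h / 2) + r₀)
    (hr₁ : rightValue ε r k (cellAverage u x h) (-1) = u (x - h / 2) + r₁)
    (hL : |(f (u (x + h / 2) + l₀) - f (u (x + h / 2)))
      - (f (u (x - h / 2) + l₁) - f (u (x - h / 2)))| ≤ L)
    (hR : |(f (u (x + h / 2) + r₀) - f (u (x + h / 2)))
      - (f (u (x - h / 2) + r₁) - f (u (x - h / 2)))| ≤ L)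
    (hA : |l₀ - l₁| ≤ A) (hB : |r₀ - r₁| ≤ B) :
    |spatialOperator f α ε r k h (cellAverage u x h) - exactOperator f u x h|
      ≤ (2 * L + |α| * (A + B)) / 2 / h := by
  unfold spatialOperator exactOperator numericalFlux laxFriedrichs
  rw [hl₀, hl₁, hr₀, hr₁, ← sub_div, abs_div, abs_of_pos hh]
  refine div_le_div_of_nonneg_right ?_ hh.le
  set p := (f (u (x + h / 2) + l₀) - f (u (x + h / 2)))
      - (f (u (x - h / 2) + l₁) - f (u (x - h / 2))) with hp
  set q := (f (u (x + h / 2) + r₀) - f (u (x + h / 2)))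
      - (f (u (x - h / 2) + r₁) - f (u (x - h / 2))) with hq
  have h1 : |α * ((l₀ - l₁) - (r₀ - r₁))| ≤ |α| * (A + B) := by
    rw [abs_mul]
    exact mul_le_mul_of_nonneg_left ((abs_sub _ _).trans (add_le_add hA hB)) (abs_nonneg _)
  calc _ = |-(p + q + α * ((l₀ - l₁) - (r₀ - r₁))) / 2| := by
        congr 1
        rw [hp, hq]
        ring
    _ ≤ _ := by
        rw [abs_div, abs_neg, abs_two]
        refine div_le_div_of_nonneg_right ?_ zero_le_two
        refine (abs_add_three _ _ _).trans ?_
        linarith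

theorem achievesOptimalOrder_of_le {r k n : ℕ} (hn : n + 2 ≤ r) (hk : r ≤ (r - 1 - n) * (k + 1))
    {f : ℝ → ℝ} (hf : ContDiff ℝ 2 f) (α : ℝ) {u : ℝ → ℝ} {xc : ℝ} (hu : ContDiffAt ℝ ∞ u xc)
    (hne : iteratedDeriv (n + 1) u xc ≠ 0) : AchievesOptimalOrder r k f α u xc := by
  obtain ⟨δ, M, c, hδ, hM, hc, hD, hlow⟩ := exists_derivBound hu (2 * r) (n + 1) hne
  have hs : Convex ℝ (Metric.ball xc δ) := convex_ball _ _
  obtain ⟨K, h₀, hK, hh₀, herr⟩ := hD.exists_abs_reconstructError_le hn hk hs hM hc hlow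
  obtain ⟨L, hL, hinc⟩ := exists_abs_increment_sub_le hf (max M K)
  -- The cells used have centres within `h` of `x` and stencils reaching at most `(r + 1) * h`
  -- further, whence `r + 2`.
  refine ⟨L * (K * M + K) + |α| * K, δ / 2, min (min 1 h₀) (δ / (2 * (r + 2))), by positivity,
    by positivity, fun ε hε h hh hhlt x hx => ?_⟩
  have hh1 : h < 1 := hhlt.trans_le ((min_le_left _ _).trans (min_le_left _ _))
  have hhh0 : h < h₀ := hhlt.trans_le ((min_le_left _ _).trans (min_le_right _ _))
  have hhδ : h * (r + 2) < δ / 2 := by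
    have := hhlt.trans_le (min_le_right _ _)
    rw [lt_div_iff₀ (by positivity)] at this
    linarith
  have hmem : ∀ z : ℝ, |z - x| ≤ h * (r + 2) → z ∈ Metric.ball xc δ := by
    intro z hz
    rw [Metric.mem_ball, Real.dist_eq]
    have := abs_sub_le z x xc
    linarith
  have hcells : ∀ i : ℤ, |i| ≤ 1 → ∀ H : ℝ, |H| = h → ∀ ξ : ℝ, |ξ| ≤ r + 1 →
      x + i * h + H * ξ ∈ Metric.ball xc δ := by
    intro i hi H hH ξ hξ
    refine hmem _ ?_
    have hi' : |(i : ℝ)| ≤ 1 := by exact_mod_cast hi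
    calc |x + i * h + H * ξ - x| = |i * h + H * ξ| := by congr 1; ring
      _ ≤ |i * h| + |H * ξ| := abs_add_le _ _
      _ ≤ 1 * h + h * (r + 1) := by
          rw [abs_mul, abs_mul, hH, abs_of_pos hh]
          gcongr
      _ = _ := by ring
  have habs : |h| = h := abs_of_pos hh
  have hnabs : |-h| = h := by rw [abs_neg, habs]
  have hpm : h ^ (2 * r - 1) ≤ 1 := pow_le_one₀ hh.le hh1.le
  have hsucc : h ^ (2 * r) = h * h ^ (2 * r - 1) := by
    rw [← pow_succ', Nat.sub_add_cancel (by omega : 1 ≤ 2 * r)]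
  have hhalf : ∀ t : ℝ, |t| ≤ 1 → x + t * h ∈ Metric.ball xc δ := fun t ht => by
    refine hmem _ ?_
    rw [add_sub_cancel_left, abs_mul, habs, mul_comm]
    exact mul_le_mul_of_nonneg_left (by linarith [(Nat.cast_nonneg r : (0 : ℝ) ≤ r)]) hh.le
  have hp : x + h / 2 ∈ Metric.ball xc δ := by
    have := hhalf (1 / 2) (by norm_num [abs_of_pos])
    rwa [show x + 1 / 2 * h = x + h / 2 by ring] at this
  have hm : x - h / 2 ∈ Metric.ball xc δ := by
    have := hhalf (-(1 / 2)) (by rw [abs_neg]; norm_num [abs_of_pos])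
    rwa [show x + -(1 / 2) * h = x - h / 2 by ring] at this
  have hbu : ∀ z ∈ Metric.ball xc δ, |u z| ≤ max M K := fun z hz => by
    have := hD.bound 0 (Nat.zero_le _) z hz
    rw [iteratedDeriv_zero] at this
    exact this.trans (le_max_left _ _)
  have hdu : |u (x + h / 2) - u (x - h / 2)| ≤ M * h := by
    have := hD.abs_iteratedDeriv_sub_le hs (n := 0) (by omega) hp hm
    rwa [iteratedDeriv_zero, show x + h / 2 - (x - h / 2) = h by ring, habs] at this
  have hflux : ∀ e₁ e₂ : ℝ, |e₁| ≤ K * h ^ (2 * r - 1) → |e₂| ≤ K * h ^ (2 * r - 1) →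
      |e₁ - e₂| ≤ K * h ^ (2 * r) → |(f (u (x + h / 2) + e₁) - f (u (x + h / 2)))
        - (f (u (x - h / 2) + e₂) - f (u (x - h / 2)))| ≤ L * ((K * M + K) * h ^ (2 * r)) := by
    intro e₁ e₂ h1 h2 h12
    have hKle : K * h ^ (2 * r - 1) ≤ max M K :=
      (mul_le_of_le_one_right hK hpm).trans (le_max_right _ _)
    refine (hinc _ _ _ _ (hbu _ hp) (h1.trans hKle) (hbu _ hm) (h2.trans hKle)).trans
      (mul_le_mul_of_nonneg_left ?_ hL)
    calc _ ≤ K * h ^ (2 * r - 1) * (M * h) + K * h ^ (2 * r) := by gcongr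
      _ = _ := by rw [hsucc]; ring
  have hcell : ∀ i j : ℤ, |i| ≤ 1 → |j| ≤ 1 → |i - j| ≤ 1 → ∀ H : ℝ, |H| = h →
      |reconstructError ε r k u (x + i * h) H| ≤ K * h ^ (2 * r - 1) ∧
      |reconstructError ε r k u (x + i * h) H - reconstructError ε r k u (x + j * h) H|
        ≤ K * h ^ (2 * r) := by
    intro i j hi hj hij H hH
    have h1 := herr ε hε H (by rwa [hH]) (by rwa [hH]) (x + i * h) (hcells i hi H hH)
    rw [hH] at h1
    refine ⟨h1.1, h1.2 (x + j * h) (hcells j hj H hH) ?_⟩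
    have hij' : |(i : ℝ) - j| ≤ 1 := by exact_mod_cast hij
    rw [show x + i * h - (x + j * h) = (i - j : ℝ) * h by ring, abs_mul, habs]
    exact mul_le_of_le_one_left hh.le hij'
  -- At the right and left interfaces of `I_0`, `u^-` comes from the cells `0` and `-1`, and `u^+`
  -- from the cells `1` and `0` with size `-h`.
  have hA := hcell 0 (-1) (by norm_num) (by norm_num) (by norm_num) h habs
  have hA' := (hcell (-1) 0 (by norm_num) (by norm_num) (by norm_num) h habs).1
  have hB := hcell 1 0 (by norm_num) (by norm_num) (by norm_num) (-h) hnabs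
  have hB' := (hcell 0 1 (by norm_num) (by norm_num) (by norm_num) (-h) hnabs).1
  have hint₀ : x + ((0 : ℤ) : ℝ) * h + h * (1 / 2) = x + h / 2 := by push_cast; ring
  have hint₁ : x + ((-1 : ℤ) : ℝ) * h + h * (1 / 2) = x - h / 2 := by push_cast; ring
  have hl₀ := leftValue_cellAverage ε r k u x hh.ne' 0
  have hl₁ := leftValue_cellAverage ε r k u x hh.ne' (-1)
  have hr₀ := rightValue_cellAverage ε r k u x hh.ne' 0
  have hr₁ := rightValue_cellAverage ε r k u x hh.ne' (-1)
  rw [hint₀] at hl₀ hr₀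
  rw [hint₁] at hl₁ hr₁
  rw [zero_add] at hr₀
  rw [neg_add_cancel] at hr₁
  refine (abs_spatialOperator_sub_le hh hl₀ hl₁ hr₀ hr₁ (hflux _ _ hA.1 hA' hA.2)
    (hflux _ _ hB.1 hB' hB.2) hA.2 hB.2).trans (le_of_eq ?_)
  rw [hsucc]
  field_simp
  ring

end WENO

end

/-! ### The exponent condition in the three cases -/

theorem mainTheorem6 (r k ncp : ℕ) (hr : 2 ≤ r) (hncp : ncp < r - 1)
    (hk : (ncp = 0 ∧ 1 ≤ k) ∨ (ncp = 1 ∧ 1 ≤ k ∧ (r = 3 → 2 ≤ k)) ∨ (ncp = 2 ∧ 3 ≤ k))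
    (f : ℝ → ℝ) (hf : ContDiff ℝ 2 f) (α : ℝ)
    (u : ℝ → ℝ) (xc : ℝ) (hu : ContDiffAt ℝ ∞ u xc)
    (hcp : WENO.HasCriticalOrder u xc ncp) :
    WENO.AchievesOptimalOrder r k f α u xc := by
  refine WENO.achievesOptimalOrder_of_le (n := ncp) (by omega) ?_ hf α hu hcp.2
  obtain ⟨p, hp⟩ := Nat.exists_eq_add_of_lt hncp
  rw [show r - 1 - ncp = p + 1 by omega]
  rcases hk with ⟨rfl, hk⟩ | ⟨rfl, hk, hk3⟩ | ⟨rfl, hk⟩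
  · nlinarith [show r = p + 2 by omega]
  · have hrp : r = p + 3 := by omega
    -- For `r = 3` the condition reads `3 ≤ k + 1`, which is why `k ≥ 2` is required there; for `r ≥
    -- 4`, `2 * (r - 2) ≥ r` suffices.
    rcases Nat.eq_zero_or_pos p with rfl | hp0
    · have := hk3 (by omega)
      omega
    · nlinarith
  · nlinarith [show r = p + 4 by omega]
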